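/- Let $r,s$ be positive integers with $r+s\equiv 0 \pmod 8$, and let $f(\tau)=\eta^3(r\tau)\,\eta^3(s\tau)$ for $\operatorname{Im}\tau>0$, where $\eta(\tau)=e^{2\pi i\tau/24}\prod_{n\ge 1}(1-e^{2\pi i n\tau})$ is the Dedekind eta function. Write the Fourier expansion of $f$ as $f(\tau)=\sum_{n\ge1}a_n e^{2\pi i n\tau}$, and let $L(f,\cdot)$ be the entire function that continues the Dirichlet series $\sum_{n\ge1}a_n n^{-z}$ from its half-plane of absolute convergence. Let $$K(k)=\int_0^1\frac{du}{\sqrt{(1-u^2)(1-k^2u^2)}},\qquad k'=\sqrt{1-k^2},$$ and for real $p>0$ let $k_p$, the $p$-th singular value (singular modulus) of $K$, be the unique $k\in(0,1)$ with $K(k')/K(k)=\sqrt p$; write $k_p'=\sqrt{1-k_p^2}$. Then $f$ has such a Fourier expansion, the continuation $L(f,\cdot)$ and the singular value $k_{r/s}$ exist and are unique, and with $q=e^{-\pi\sqrt{r/s}}$ one has $$L(f,2)=\frac{8\pi^2}{\sqrt{rs^3}}\Bigl(\sum_{n=0}^{\infty}(-1)^{\frac{n(n+1)}2}q^{\frac{(2n+1)^2}{8}}\Bigr)^4=\frac{8}{\sqrt{rs^3}}\;k_{r/s}\,k'_{r/s}\,K^2(k_{r/s}),$$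 where the series over $n$ converges absolutely. -/

import Mathlib

noncomputable section

/-- The function `f(τ) = η³(rτ) η³(sτ)` on the upper half-plane, with `η` the Dedekind eta
function. -/
def etaProduct (r s : ℕ) (τ : UpperHalfPlane) : ℂ :=
  ModularForm.eta ((r : ℂ) * (τ : ℂ)) ^ 3 * ModularForm.eta ((s : ℂ) * (τ : ℂ)) ^ 3

/-- The Fourier coefficients `a_n` of a function of period `1` on the upper half-plane. -/
def fourierCoefficient (f : UpperHalfPlane → ℂ) (n : ℕ) : ℂ :=
  (UpperHalfPlane.qExpansion 1 f).coeff n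

/-- `L` is the `L`-function of the sequence `a`: the Dirichlet series `∑ a_n / n ^ s` converges
absolutely on some right half-plane, and `L` is its continuation to an entire function. By the
identity theorem there is at most one such `L`. -/
structure IsLFunction (a : ℕ → ℂ) (L : ℂ → ℂ) : Prop where
  abscissa_lt_top : LSeries.abscissaOfAbsConv a < ⊤
  entire : Differentiable ℂ L
  eq_LSeries : ∀ s : ℂ, LSeries.abscissaOfAbsConv a < (s.re : EReal) → L s = LSeries a s

/-- The complete elliptic integral of the first kind (as a function of the modulus `k`). -/
def ellipticK (k : ℝ) : ℝ :=
  ∫ u in (0 : ℝ)..1, 1 / Real.sqrt ((1 - u ^ 2) * (1 - k ^ 2 * u ^ 2))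

/-- The complementary modulus `k' = √(1 - k²)`. -/
def complementaryModulus (k : ℝ) : ℝ := Real.sqrt (1 - k ^ 2)

/-- `k` is the `p`-th singular value (singular modulus) of `K`: the modulus `0 < k < 1` with
`K'(k) / K(k) = √p`, where `K'(k) = K(k')`. -/
def IsSingularValue (p k : ℝ) : Prop :=
  0 < k ∧ k < 1 ∧ ellipticK (complementaryModulus k) / ellipticK k = Real.sqrt p

end

namespace EtaTheta

open Filter Topology Finset

noncomputable section

/-! ### The Jacobi triple product -/

/-! The continuation of $L(f,\cdot)$ is a Mellin transform, so $L(f,2)=(2\pi)^2\int_0^\infty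
f(iy)\,y\,dy$. Jacobi's series for $\eta^3$ (`hasSum_eta_pow_three`) is inserted for $\eta^3(riy)$
directly, and for $\eta^3(siy)$ after the inversion $y\mapsto 1/(sy)$. The powers of $y$ combine to
$y^{-1/2}$, and each term becomes a Bessel integral of order $1/2$, which is elementary
(`integral_inv_sqrt_mul_exp`): $\int_0^\infty
y^{-1/2}e^{-\alpha^2y-\beta^2/y}dy=\frac{\sqrt\pi}{\alpha}e^{-2\alpha\beta}$. Here $\alpha$ is
proportional to $2m+1$ and cancels that factor, leaving $\sum_{m,n}(-1)^{m+n}(2n+1)Q^{(2m+1)(2n+1)}$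
with $Q=e^{-\pi\sqrt{r/s}/2}=\sqrt q$.

This twisted Lambert series is Legendre's four-triangular-numbers series evaluated at $iQ$, hence a
fourth power of a theta series (`lambertOdd_eq`, `hasSum_twisted_lambert`). Legendre's theorem comes
from differentiating quadratic theta identities: $(\text{odd Lambert part})/(q\psi^4)$ is invariant
under $q\mapsto q^2$, so it equals its limit at $q=0$.

For the form with $k$, $k'$, $K$, the doubling formulas say that $\varphi(q)^2,\varphi(-q)^2$ run
through the arithmetic-geometric mean iteration as $q\mapsto q^2$. Gauss's invariance of the
symmetric elliptic integral then gives $K=\frac\pi2\varphi(q)^2$, and the theta inversion gives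
$K'/K=\sqrt{r/s}$. Strict monotonicity of $K$ makes the singular value unique; the identity theorem
does the same for $L$. -/

/-- The terms `z ^ n * q ^ (n ^ 2)` are the terms of a Jacobi theta function. -/
lemma exists_exp_eq {q z : ℂ} (hq0 : q ≠ 0) (hq : ‖q‖ < 1) (hz : z ≠ 0) :
    ∃ τ w : ℂ, 0 < τ.im ∧ ∀ n : ℤ, jacobiTheta₂_term n w τ = z ^ n * q ^ (n ^ 2) := by
  have hI : (Real.pi * Complex.I : ℂ) ≠ 0 := by simp [Real.pi_ne_zero]
  have h2I : (2 * Real.pi * Complex.I : ℂ) ≠ 0 := Complex.two_pi_I_ne_zero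
  have h1 : Complex.exp (Real.pi * Complex.I * (Complex.log q / (Real.pi * Complex.I))) = q := by
    rw [mul_div_cancel₀ _ hI, Complex.exp_log hq0]
  refine ⟨Complex.log q / (Real.pi * Complex.I), Complex.log z / (2 * Real.pi * Complex.I), ?_, ?_⟩
  · have h2 := congrArg norm h1
    rw [Complex.norm_exp] at h2
    have h3 : (Real.pi * Complex.I * (Complex.log q / (Real.pi * Complex.I))).re =
        -(Real.pi * (Complex.log q / (Real.pi * Complex.I)).im) := by
      rw [mul_assoc, Complex.re_ofReal_mul, Complex.I_mul_re, mul_neg]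
    rw [h3] at h2
    rw [← h2, Real.exp_lt_one_iff] at hq
    exact pos_of_mul_pos_right (by linarith) Real.pi_pos.le
  · intro n
    have hz1 : Complex.exp (2 * Real.pi * Complex.I *
        (Complex.log z / (2 * Real.pi * Complex.I))) = z := by
      rw [mul_div_cancel₀ _ h2I, Complex.exp_log hz]
    rw [jacobiTheta₂_term, Complex.exp_add]
    congr 1
    · rw [mul_right_comm, mul_comm, Complex.exp_int_mul, hz1]
    · rw [mul_right_comm, mul_comm, ← Int.cast_pow, Complex.exp_int_mul, h1]

lemma summable_zpow_mul_zpow_sq {q z : ℂ} (hq0 : q ≠ 0) (hq : ‖q‖ < 1) (hz : z ≠ 0) :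
    Summable fun n : ℤ => z ^ n * q ^ (n ^ 2) := by
  obtain ⟨τ, w, hτ, h⟩ := exists_exp_eq hq0 hq hz
  simpa only [h] using (summable_jacobiTheta₂_term_iff w τ).2 hτ

lemma summable_mul_zpow_mul_zpow_sq {q z : ℂ} (hq0 : q ≠ 0) (hq : ‖q‖ < 1) (hz : z ≠ 0) :
    Summable fun n : ℤ => (n : ℂ) * (z ^ n * q ^ (n ^ 2)) := by
  obtain ⟨τ, w, hτ, h⟩ := exists_exp_eq hq0 hq hz
  have := (summable_jacobiTheta₂'_term_iff w τ).2 hτ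
  simp only [jacobiTheta₂'_term, h, mul_assoc (2 * Real.pi * Complex.I : ℂ)] at this
  exact (summable_mul_left_iff Complex.two_pi_I_ne_zero).1 this

/-- The finite product `(q²; q²)_n`. -/
def evenProd (q : ℂ) (n : ℕ) : ℂ := ∏ i ∈ range n, (1 - (q ^ 2) ^ (i + 1))

/-- The infinite product `(x; x)_∞`. -/
def eulerProd (x : ℂ) : ℂ := ∏' n : ℕ, (1 - x ^ (n + 1))

lemma one_sub_pow_ne_zero {x : ℂ} (hx : ‖x‖ < 1) (n : ℕ) : 1 - x ^ (n + 1) ≠ 0 := by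
  intro h
  have h1 : ‖x ^ (n + 1)‖ = 1 := by rw [← sub_eq_zero.1 h, norm_one]
  rw [norm_pow] at h1
  exact (pow_lt_one₀ (norm_nonneg _) hx n.succ_ne_zero).ne h1

lemma evenProd_ne_zero {q : ℂ} (hq : ‖q‖ < 1) (n : ℕ) : evenProd q n ≠ 0 :=
  prod_ne_zero_iff.2 fun i _ => one_sub_pow_ne_zero
    (by rw [norm_pow]; exact pow_lt_one₀ (norm_nonneg _) hq two_ne_zero) i

lemma eulerProd_ne_zero {x : ℂ} (hx : ‖x‖ < 1) : eulerProd x ≠ 0 := by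
  have := tprod_one_add_ne_zero_of_summable (f := fun n : ℕ => -x ^ (n + 1))
    (fun i => by simpa [← sub_eq_add_neg] using one_sub_pow_ne_zero hx i)
    (by simpa using (summable_nat_add_iff 1).2 (summable_geometric_of_lt_one (norm_nonneg x) hx))
  simpa [← sub_eq_add_neg] using! this

lemma tendsto_prod_eulerProd {x : ℂ} (hx : ‖x‖ < 1) :
    Tendsto (fun n => ∏ i ∈ range n, (1 - x ^ (i + 1))) atTop (𝓝 (eulerProd x)) :=
  (ModularForm.multipliable_one_sub_pow hx).hasProd.tendsto_prod_nat

lemma norm_sq_lt_one {q : ℂ} (hq : ‖q‖ < 1) : ‖q ^ 2‖ < 1 := by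
  rw [norm_pow]; exact pow_lt_one₀ (norm_nonneg _) hq two_ne_zero

/-- The reciprocal of `(q²; q²)_m`, extended by zero to negative `m`. -/
def evenProdInv (q : ℂ) (m : ℤ) : ℂ := if 0 ≤ m then (evenProd q m.toNat)⁻¹ else 0

lemma evenProdInv_natCast (q : ℂ) (n : ℕ) : evenProdInv q n = (evenProd q n)⁻¹ := by
  simp [evenProdInv]

/-- The extension by zero is consistent at the boundary: for $m=0$ the factor $1-q^0$ vanishes. The
recurrence below therefore needs no boundary cases. -/
lemma evenProdInv_sub_one {q : ℂ} (hq : ‖q‖ < 1) (m : ℤ) :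
    evenProdInv q (m - 1) = (1 - q ^ (2 * m)) * evenProdInv q m := by
  rcases lt_trichotomy m 0 with h | rfl | h
  · rw [evenProdInv, evenProdInv, if_neg (by lia), if_neg (by lia), mul_zero]
  · simp [evenProdInv]
  · obtain ⟨n, rfl⟩ : ∃ n : ℕ, m = n + 1 := ⟨(m - 1).toNat, by lia⟩
    have h1 : ((n : ℤ) + 1) = ((n + 1 : ℕ) : ℤ) := by simp
    rw [add_sub_cancel_right, h1, evenProdInv_natCast, evenProdInv_natCast]
    have h2 : evenProd q (n + 1) = evenProd q n * (1 - q ^ (2 * ((n + 1 : ℕ) : ℤ))) := by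
      rw [evenProd, prod_range_succ, evenProd, ← pow_mul]
      norm_cast
    have h3 := evenProd_ne_zero hq (n + 1)
    rw [h2] at h3 ⊢
    have := right_ne_zero_of_mul h3
    have := left_ne_zero_of_mul h3
    field_simp

/-- The coefficients of the finite form of the triple product. -/
def tripleCoeff (q : ℂ) (N : ℕ) (k : ℤ) : ℂ :=
  evenProd q (2 * N) * (evenProdInv q (N + k) * evenProdInv q (N - k))

/-- The finite triple product. -/
def tripleProd (q z : ℂ) (N : ℕ) : ℂ :=
  ∏ i ∈ range N, ((1 + z * q ^ (2 * i + 1)) * (1 + z⁻¹ * q ^ (2 * i + 1)))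

lemma tripleCoeff_eq_zero (q : ℂ) {N : ℕ} {k : ℤ} (h : (N : ℤ) < |k|) :
    tripleCoeff q N k = 0 := by
  rcases lt_abs.1 h with h | h
  · simp [tripleCoeff, evenProdInv, show ¬ (k ≤ N) by lia]
  · simp [tripleCoeff, evenProdInv, show ¬ (0 ≤ N + k) by lia]

/-- The new factor of the finite product is $1+q^{4N+2}+q^{2N+1}(z+z^{-1})$; this is the resulting
comparison of coefficients of $z^k$. With everything expressed through $q^{2a}$, $q^{2b}$ and the
reciprocals at $a$ and $b$, it is a polynomial identity. -/
lemma tripleCoeff_succ {q : ℂ} (hq0 : q ≠ 0) (hq : ‖q‖ < 1) (N : ℕ) (k : ℤ) :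
    tripleCoeff q (N + 1) k * q ^ (k ^ 2) =
      (1 + q ^ (4 * N + 2)) * (tripleCoeff q N k * q ^ (k ^ 2)) +
      q ^ (2 * N + 1) * (tripleCoeff q N (k - 1) * q ^ ((k - 1) ^ 2) +
        tripleCoeff q N (k + 1) * q ^ ((k + 1) ^ 2)) := by
  set a : ℤ := N + 1 + k with ha
  set b : ℤ := N + 1 - k with hb
  have e1 : evenProdInv q (N + k) = (1 - q ^ (2 * a)) * evenProdInv q a := by
    rw [← evenProdInv_sub_one hq]; congr 1; lia
  have e2 : evenProdInv q (N - k) = (1 - q ^ (2 * b)) * evenProdInv q b := by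
    rw [← evenProdInv_sub_one hq]; congr 1; lia
  have e3 : evenProdInv q (N + (k - 1)) =
      (1 - q ^ (2 * (a - 1))) * ((1 - q ^ (2 * a)) * evenProdInv q a) := by
    rw [← evenProdInv_sub_one hq, ← evenProdInv_sub_one hq]; congr 1; lia
  have e4 : evenProdInv q (N - (k + 1)) =
      (1 - q ^ (2 * (b - 1))) * ((1 - q ^ (2 * b)) * evenProdInv q b) := by
    rw [← evenProdInv_sub_one hq, ← evenProdInv_sub_one hq]; congr 1; lia
  have e5 : (N : ℤ) - (k - 1) = b := by lia
  have e6 : (N : ℤ) + (k + 1) = a := by lia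
  have f1 : q ^ (2 * N + 1) * q ^ ((k - 1) ^ 2) = q ^ (2 * b) * q ^ (k ^ 2) := by
    rw [← zpow_natCast q (2 * N + 1), ← zpow_add₀ hq0, ← zpow_add₀ hq0]
    congr 1; push_cast; rw [hb]; ring
  have f2 : q ^ (2 * N + 1) * q ^ ((k + 1) ^ 2) = q ^ (2 * a) * q ^ (k ^ 2) := by
    rw [← zpow_natCast q (2 * N + 1), ← zpow_add₀ hq0, ← zpow_add₀ hq0]
    congr 1; push_cast; rw [ha]; ring
  have g1 : q ^ (2 * (a - 1)) = q ^ (2 * a) * (q ^ 2)⁻¹ := by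
    rw [mul_sub, zpow_sub₀ hq0, div_eq_mul_inv]; norm_cast
  have g2 : q ^ (2 * (b - 1)) = q ^ (2 * b) * (q ^ 2)⁻¹ := by
    rw [mul_sub, zpow_sub₀ hq0, div_eq_mul_inv]; norm_cast
  have g3 : q ^ (4 * N + 2) = q ^ (2 * a) * q ^ (2 * b) * (q ^ 2)⁻¹ := by
    rw [← zpow_add₀ hq0, ← zpow_natCast, ← zpow_natCast, ← zpow_neg, ← zpow_add₀ hq0]
    congr 1; push_cast; lia
  have g4 : q ^ (4 * N + 4) = q ^ (2 * a) * q ^ (2 * b) := by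
    rw [← zpow_add₀ hq0, ← zpow_natCast]
    congr 1; push_cast; lia
  have p1 : evenProd q (2 * (N + 1)) =
      evenProd q (2 * N) * (1 - q ^ (4 * N + 2)) * (1 - q ^ (4 * N + 4)) := by
    rw [evenProd, show 2 * (N + 1) = 2 * N + 1 + 1 by ring, prod_range_succ, prod_range_succ,
      evenProd]
    congr 2 <;> ring
  have hc : ((N + 1 : ℕ) : ℤ) = N + 1 := by simp
  rw [mul_add (q ^ (2 * N + 1)), mul_left_comm (q ^ (2 * N + 1)), mul_left_comm (q ^ (2 * N + 1)),
    f1, f2]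
  simp only [tripleCoeff, hc, ← ha, ← hb, e1, e2, e3, e4, e5, e6, p1, g1, g2, g3, g4]
  ring

lemma hasSum_tripleProd {q z : ℂ} (hq0 : q ≠ 0) (hq : ‖q‖ < 1) (hz : z ≠ 0) (N : ℕ) :
    HasSum (fun k : ℤ => tripleCoeff q N k * q ^ (k ^ 2) * z ^ k) (tripleProd q z N) := by
  induction N with
  | zero =>
    convert hasSum_single (0 : ℤ) ?_ using 1
    · simp [tripleProd, tripleCoeff, evenProdInv, evenProd]
    · intro k hk
      rw [tripleCoeff_eq_zero q (by simpa using hk), zero_mul, zero_mul]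
  | succ N ih =>
    have h1 : tripleProd q z (N + 1) = (1 + q ^ (4 * N + 2)) * tripleProd q z N +
        q ^ (2 * N + 1) * (z * tripleProd q z N + z⁻¹ * tripleProd q z N) := by
      rw [tripleProd, prod_range_succ, ← tripleProd]
      field_simp
      ring
    have h2 := (Equiv.subRight (1 : ℤ)).hasSum_iff.2 ih
    have h3 := (Equiv.addRight (1 : ℤ)).hasSum_iff.2 ih
    rw [h1]
    refine ((ih.mul_left _).add (((h2.mul_left z).add (h3.mul_left z⁻¹)).mul_left _)).congr_fun ?_
    intro k
    simp only [Function.comp_apply, Equiv.subRight_apply, Equiv.coe_addRight]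
    rw [tripleCoeff_succ hq0 hq, zpow_sub_one₀ hz, zpow_add_one₀ hz]
    field_simp

lemma tendsto_evenProd {q : ℂ} (hq : ‖q‖ < 1) :
    Tendsto (evenProd q) atTop (𝓝 (eulerProd (q ^ 2))) :=
  tendsto_prod_eulerProd (norm_sq_lt_one hq)

lemma tendsto_evenProdInv {q : ℂ} (hq : ‖q‖ < 1) :
    Tendsto (evenProdInv q) atTop (𝓝 (eulerProd (q ^ 2))⁻¹) := by
  have h1 : Tendsto (fun m : ℤ => (evenProd q m.toNat)⁻¹) atTop (𝓝 (eulerProd (q ^ 2))⁻¹) :=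
    ((tendsto_evenProd hq).comp
      (tendsto_atTop_atTop.2 fun n : ℕ => ⟨(n : ℤ), fun m hm => by lia⟩ :
        Tendsto Int.toNat atTop atTop)).inv₀
      (eulerProd_ne_zero (norm_sq_lt_one hq))
  refine h1.congr' ?_
  filter_upwards [eventually_ge_atTop 0] with m hm
  simp [evenProdInv, hm]

lemma tendsto_tripleCoeff {q : ℂ} (hq : ‖q‖ < 1) (k : ℤ) :
    Tendsto (fun N : ℕ => tripleCoeff q N k) atTop (𝓝 (eulerProd (q ^ 2))⁻¹) := by
  have hA := eulerProd_ne_zero (norm_sq_lt_one hq)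
  have h1 : Tendsto (fun N : ℕ => evenProd q (2 * N)) atTop (𝓝 (eulerProd (q ^ 2))) :=
    (tendsto_evenProd hq).comp (tendsto_id.const_mul_atTop' two_pos)
  have h2 : Tendsto (fun N : ℕ => evenProdInv q (N + k)) atTop (𝓝 (eulerProd (q ^ 2))⁻¹) :=
    (tendsto_evenProdInv hq).comp (tendsto_atTop_add_const_right _ _ tendsto_natCast_atTop_atTop)
  have h3 : Tendsto (fun N : ℕ => evenProdInv q (N - k)) atTop (𝓝 (eulerProd (q ^ 2))⁻¹) :=
    (tendsto_evenProdInv hq).comp (tendsto_atTop_add_const_right _ (-k) tendsto_natCast_atTop_atTop)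
  have := h1.mul (h2.mul h3)
  rwa [mul_inv_cancel_left₀ hA] at this

/-- Convergent sequences are bounded; uniformity in both $N$ and $k$ is what dominated convergence
requires. -/
lemma exists_norm_tripleCoeff_le {q : ℂ} (hq : ‖q‖ < 1) :
    ∃ C : ℝ, ∀ N k, ‖tripleCoeff q N k‖ ≤ C := by
  obtain ⟨C₁, h₁⟩ := (Metric.isBounded_range_of_tendsto _ (tendsto_evenProd hq)).exists_norm_le
  obtain ⟨C₂, h₂⟩ := (Metric.isBounded_range_of_tendsto _ ((tendsto_evenProd hq).inv₀
    (eulerProd_ne_zero (norm_sq_lt_one hq)))).exists_norm_le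
  have hC₁ : 0 ≤ C₁ := (norm_nonneg _).trans (h₁ _ ⟨0, rfl⟩)
  have hC₂ : 0 ≤ C₂ := (norm_nonneg _).trans (h₂ _ ⟨0, rfl⟩)
  have h₃ : ∀ m, ‖evenProdInv q m‖ ≤ C₂ := by
    intro m
    rw [evenProdInv]
    split_ifs
    · exact h₂ _ ⟨_, rfl⟩
    · simpa using hC₂
  refine ⟨C₁ * (C₂ * C₂), fun N k => ?_⟩
  rw [tripleCoeff, norm_mul, norm_mul]
  have := h₁ _ ⟨2 * N, rfl⟩
  have := h₃ (N + k)
  have := h₃ (N - k)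
  gcongr

/-- Passage to the limit in finite forms of the triple product. -/
lemma tendsto_tsum_tripleCoeff {q : ℂ} (hq : ‖q‖ < 1) {g : ℤ → ℂ} (hg : Summable g) :
    Tendsto (fun N => ∑' k : ℤ, tripleCoeff q N k * g k) atTop
      (𝓝 ((eulerProd (q ^ 2))⁻¹ * ∑' k : ℤ, g k)) := by
  obtain ⟨C, hC⟩ := exists_norm_tripleCoeff_le hq
  rw [← tsum_mul_left]
  refine tendsto_tsum_of_dominated_convergence (bound := fun k => C * ‖g k‖)
    (hg.norm.mul_left C) (fun k => (tendsto_tripleCoeff hq k).mul_const _) ?_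
  refine Eventually.of_forall fun N k => ?_
  rw [norm_mul]
  gcongr
  exact hC N k

/-- **Jacobi triple product.** -/
theorem tendsto_tripleProd {q z : ℂ} (hq0 : q ≠ 0) (hq : ‖q‖ < 1) (hz : z ≠ 0) :
    Tendsto (tripleProd q z) atTop
      (𝓝 ((eulerProd (q ^ 2))⁻¹ * ∑' k : ℤ, z ^ k * q ^ (k ^ 2))) := by
  refine (tendsto_tsum_tripleCoeff hq (summable_zpow_mul_zpow_sq hq0 hq hz)).congr fun N => ?_
  rw [← (hasSum_tripleProd hq0 hq hz N).tsum_eq]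
  exact tsum_congr fun k => by ring

/-! ### Gauss's product and Jacobi's identity -/

/-- The theta function `∑ q ^ (n ^ 2)`. -/
def phi (q : ℂ) : ℂ := ∑' n : ℤ, q ^ (n ^ 2)

lemma neg_zpow_sq (q : ℂ) (n : ℤ) : (-q) ^ (n ^ 2) = (-1) ^ n * q ^ (n ^ 2) := by
  rw [← neg_one_mul, mul_zpow]
  congr 1
  rcases Int.even_or_odd n with h | h
  · rw [h.neg_one_zpow, (h.pow_of_ne_zero two_ne_zero).neg_one_zpow]
  · rw [h.neg_one_zpow, (h.pow).neg_one_zpow]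

/-- **Gauss's product** for `∑ (-1) ^ n q ^ (n ^ 2)`. -/
theorem phi_neg_mul_eulerProd {q : ℂ} (hq0 : q ≠ 0) (hq : ‖q‖ < 1) :
    phi (-q) * eulerProd (q ^ 2) = eulerProd q ^ 2 := by
  have hA := eulerProd_ne_zero (norm_sq_lt_one hq)
  have h1 := tendsto_tripleProd hq0 hq (z := -1) (by simp)
  simp_rw [← neg_zpow_sq] at h1
  have h2 := (h1.mul ((tendsto_evenProd hq).pow 2))
  -- At $z=-1$ the triple product is the square of the odd factors $1-q^{2i+1}$; the squared even
  -- product supplies the missing factors.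
  have h3 : Tendsto (fun N => (∏ i ∈ range (2 * N), (1 - q ^ (i + 1))) ^ 2) atTop
      (𝓝 (eulerProd q ^ 2)) :=
    ((tendsto_prod_eulerProd hq).comp (tendsto_id.const_mul_atTop' two_pos)).pow 2
  have h4 := tendsto_nhds_unique (h2.congr fun N => ?_) h3
  · rw [← h4, phi]
    field_simp
  · induction N with
    | zero => simp [tripleProd, evenProd]
    | succ N ih =>
      rw [show 2 * (N + 1) = 2 * N + 1 + 1 by ring, prod_range_succ, prod_range_succ, mul_pow,
        mul_pow, ← ih, tripleProd, prod_range_succ, ← tripleProd, evenProd, prod_range_succ,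
        ← evenProd]
      norm_num
      ring

/-- **Jacobi's identity** for the cube of Euler's product. -/
theorem eulerProd_pow_three {q : ℂ} (hq0 : q ≠ 0) (hq : ‖q‖ < 1) :
    eulerProd (q ^ 2) ^ 3 = ∑' k : ℤ, (k : ℂ) * ((-q) ^ k * q ^ (k ^ 2)) := by
  have hA := eulerProd_ne_zero (norm_sq_lt_one hq)
  -- At $z=-wq$ the finite product has the factor $1-w^{-1}$, and `G` is its cofactor.
  -- Differentiating at $w=1$ gives `G N 1` on the product side and brings down $k$ on the series
  -- side.
  let G : ℕ → ℂ → ℂ := fun N w => (∏ i ∈ range N, ((1 - w * q ^ (2 * i + 2)) *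
    (1 - w⁻¹ * q ^ (2 * i + 2)))) * (1 - w * q ^ (2 * N + 2))
  have hG : ∀ N w, w ≠ 0 → tripleProd q (-(w * q)) (N + 1) = (1 - w⁻¹) * G N w := by
    intro N w hw
    induction N with
    | zero => simp [tripleProd, G]; field_simp; ring
    | succ N ih =>
      rw [tripleProd, prod_range_succ, ← tripleProd, ih]
      simp only [G, prod_range_succ]
      field_simp
      ring
  have key : ∀ N, ∑' k : ℤ, tripleCoeff q (N + 1) k * ((k : ℂ) * ((-q) ^ k * q ^ (k ^ 2))) =
      G N 1 := by
    intro N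
    -- The series is a finite sum, so termwise differentiation needs no justification.
    have hfin : ∀ k ∉ Finset.Icc (-(N + 1) : ℤ) (N + 1), tripleCoeff q (N + 1) k = 0 := by
      intro k hk
      refine tripleCoeff_eq_zero q ?_
      rw [Finset.mem_Icc, ← abs_le] at hk
      push_cast
      lia
    rw [tsum_eq_sum (s := Finset.Icc (-(N + 1) : ℤ) (N + 1))
      fun k hk => by rw [hfin k hk, zero_mul]]
    have hd1 : HasDerivAt (fun w : ℂ => ∑ k ∈ Finset.Icc (-(N + 1) : ℤ) (N + 1),
        tripleCoeff q (N + 1) k * q ^ (k ^ 2) * (-q) ^ k * w ^ k)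
        (∑ k ∈ Finset.Icc (-(N + 1) : ℤ) (N + 1),
          tripleCoeff q (N + 1) k * q ^ (k ^ 2) * (-q) ^ k * ((k : ℂ) * 1 ^ (k - 1))) 1 :=
      HasDerivAt.fun_sum fun k _ => (hasDerivAt_zpow k 1 (.inl one_ne_zero)).const_mul _
    have hGd : DifferentiableAt ℂ (G N) 1 := by
      refine DifferentiableAt.mul (DifferentiableAt.fun_finsetProd fun i _ => ?_) (by fun_prop)
      exact DifferentiableAt.mul (by fun_prop) (by fun_prop (disch := simp))
    have hd2 : HasDerivAt (fun w : ℂ => (1 - w⁻¹) * G N w) (G N 1) 1 := by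
      have := ((hasDerivAt_inv (one_ne_zero (α := ℂ))).const_sub 1).mul hGd.hasDerivAt
      exact this.congr_deriv (by simp)
    have heq : (fun w : ℂ => ∑ k ∈ Finset.Icc (-(N + 1) : ℤ) (N + 1),
        tripleCoeff q (N + 1) k * q ^ (k ^ 2) * (-q) ^ k * w ^ k) =ᶠ[𝓝 1]
        fun w : ℂ => (1 - w⁻¹) * G N w := by
      filter_upwards [isOpen_ne.mem_nhds (one_ne_zero (α := ℂ))] with w hw
      rw [← hG N w hw, ← (hasSum_tripleProd hq0 hq
        (neg_ne_zero.2 (mul_ne_zero hw hq0)) (N + 1)).tsum_eq,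
        tsum_eq_sum (s := Finset.Icc (-(N + 1) : ℤ) (N + 1))
          fun k hk => by rw [hfin k hk, zero_mul, zero_mul]]
      refine Finset.sum_congr rfl fun k _ => ?_
      rw [← mul_neg, mul_zpow]
      ring
    rw [← hd1.unique (hd2.congr_of_eventuallyEq heq)]
    refine Finset.sum_congr rfl fun k _ => ?_
    rw [one_zpow]
    ring
  have h1 := (tendsto_tsum_tripleCoeff hq (summable_mul_zpow_mul_zpow_sq hq0 hq
    (neg_ne_zero.2 hq0))).comp (tendsto_add_atTop_nat 1)
  have h2 : Tendsto (fun N => G N 1) atTop (𝓝 (eulerProd (q ^ 2) ^ 2)) := by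
    -- This gives only the square of the Euler product; the third power comes from the factor
    -- `(eulerProd (q ^ 2))⁻¹` in the limit of the series.
    have h3 : ∀ N, evenProd q N * evenProd q (N + 1) = G N 1 := by
      intro N
      rw [evenProd, evenProd, prod_range_succ, ← mul_assoc, ← prod_mul_distrib]
      change _ = (∏ i ∈ range N, _) * _
      congr 1
      · exact prod_congr rfl fun i _ => by rw [inv_one]; ring
      · ring
    have := (tendsto_evenProd hq).mul ((tendsto_evenProd hq).comp (tendsto_add_atTop_nat 1))
    rw [← sq] at this
    exact this.congr h3
  have h3 := tendsto_nhds_unique (h1.congr key) h2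
  rw [pow_succ, ← h3]
  field_simp

end

end EtaTheta


namespace EtaTheta

open Filter Topology Finset

noncomputable section

/-! ### Theta series identities -/

/-- Splitting a sum over `ℤ × ℤ` according to the parity of the sum of the coordinates. -/
lemma tsum_prod_int_parity {F : ℤ × ℤ → ℂ} (hF : Summable F) :
    ∑' p, F p = (∑' p : ℤ × ℤ, F (p.1 + p.2, p.1 - p.2)) +
      ∑' p : ℤ × ℤ, F (p.1 + p.2 + 1, p.1 - p.2) := by
  let e : (ℤ × ℤ) ⊕ (ℤ × ℤ) → ℤ × ℤ :=
    Sum.elim (fun p => (p.1 + p.2, p.1 - p.2)) (fun p => (p.1 + p.2 + 1, p.1 - p.2))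
  have he : Function.Bijective e := by
    constructor
    · rintro (⟨a, b⟩ | ⟨a, b⟩) (⟨c, d⟩ | ⟨c, d⟩) h <;>
        simp only [e, Sum.elim_inl, Sum.elim_inr, Prod.mk.injEq] at h <;>
        first
        | (exfalso; lia)
        | (congr 2 <;> lia)
    · rintro ⟨a, b⟩
      rcases Int.even_or_odd' (a + b) with ⟨c, h | h⟩
      · exact ⟨.inl (c, a - c), by simp only [e, Sum.elim_inl, Prod.mk.injEq]; lia⟩
      · exact ⟨.inr (c, a - c - 1), by simp only [e, Sum.elim_inr, Prod.mk.injEq]; lia⟩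
  have hs : Summable (F ∘ e) := hF.comp_injective he.1
  rw [← (Equiv.ofBijective e he).tsum_eq F]
  exact Summable.tsum_sum (f := F ∘ e) (hs.comp_injective Sum.inl_injective)
    (hs.comp_injective Sum.inr_injective)

/-- The theta function `∑ q ^ (n (n + 1))`. -/
def psi (q : ℂ) : ℂ := ∑' n : ℤ, q ^ (n * (n + 1))

variable {q : ℂ}

lemma summable_phi (hq0 : q ≠ 0) (hq : ‖q‖ < 1) : Summable fun n : ℤ => q ^ (n ^ 2) := by
  simpa using summable_zpow_mul_zpow_sq hq0 hq one_ne_zero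

lemma summable_psi (hq0 : q ≠ 0) (hq : ‖q‖ < 1) : Summable fun n : ℤ => q ^ (n * (n + 1)) := by
  refine (summable_zpow_mul_zpow_sq hq0 hq hq0).congr fun n => ?_
  rw [← zpow_add₀ hq0]
  congr 1
  ring

lemma tsum_mul_tsum_prod {f g : ℤ → ℂ} (hf : Summable f) (hg : Summable g) :
    (∑' p : ℤ × ℤ, f p.1 * g p.2) = (∑' n, f n) * ∑' n, g n :=
  (tsum_mul_tsum_of_summable_norm hf.norm hg.norm).symm

lemma zpow_sq_pow (q : ℂ) (a : ℕ) (n : ℤ) : (q ^ a) ^ n = q ^ (a * n) := by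
  rw [← zpow_natCast, ← zpow_mul]

/-- The parity splitting turns $m^2+n^2$ into $2a^2+2b^2$ on the even class and into
$2a(a+1)+2b(b+1)+1$ on the odd class. -/
theorem phi_sq (hq0 : q ≠ 0) (hq : ‖q‖ < 1) :
    phi q ^ 2 = phi (q ^ 2) ^ 2 + q * psi (q ^ 2) ^ 2 := by
  have h := summable_phi hq0 hq
  have h2 := summable_phi (pow_ne_zero 2 hq0) (norm_sq_lt_one hq)
  have h3 := summable_psi (pow_ne_zero 2 hq0) (norm_sq_lt_one hq)
  rw [sq (phi q), phi, ← tsum_mul_tsum_prod h h,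
    tsum_prod_int_parity (summable_mul_of_summable_norm h.norm h.norm), sq (phi _), sq (psi _),
    phi, psi,
    ← tsum_mul_tsum_prod h2 h2, ← tsum_mul_tsum_prod h3 h3, ← tsum_mul_left]
  congr 1
  · refine tsum_congr fun p => ?_
    rw [zpow_sq_pow, zpow_sq_pow, ← zpow_add₀ hq0, ← zpow_add₀ hq0]
    congr 1
    push_cast
    ring
  · refine tsum_congr fun p => ?_
    rw [zpow_sq_pow, zpow_sq_pow, ← zpow_add₀ hq0, ← zpow_add₀ hq0, ← zpow_one_add₀ hq0]
    congr 1
    push_cast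
    ring

/-- The even class of the parity splitting gives the right-hand side. On the odd class, $b\mapsto
-b-1$ interchanges the two squares and flips the sign, so that part cancels. -/
theorem phi_mul_phi_neg (hq0 : q ≠ 0) (hq : ‖q‖ < 1) :
    phi q * phi (-q) = phi (-q ^ 2) ^ 2 := by
  have hn : ‖-q‖ < 1 := by rwa [norm_neg]
  have hn2 : ‖-q ^ 2‖ < 1 := by rw [norm_neg]; exact norm_sq_lt_one hq
  have h := summable_phi hq0 hq
  have h' := summable_phi (neg_ne_zero.2 hq0) hn
  have h2 := summable_phi (neg_ne_zero.2 (pow_ne_zero 2 hq0)) hn2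
  have hs := summable_mul_of_summable_norm h.norm h'.norm
  rw [phi, phi, ← tsum_mul_tsum_prod h h', tsum_prod_int_parity hs, sq, phi,
    ← tsum_mul_tsum_prod h2 h2]
  have hodd : ∑' p : ℤ × ℤ, q ^ ((p.1 + p.2 + 1) ^ 2) * (-q) ^ ((p.1 - p.2) ^ 2) = 0 := by
    have e := ((Equiv.prodCongr (Equiv.refl ℤ) ((Equiv.neg ℤ).trans (Equiv.subRight 1))).tsum_eq
      fun p : ℤ × ℤ => q ^ ((p.1 + p.2 + 1) ^ 2) * (-q) ^ ((p.1 - p.2) ^ 2))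
    rw [← CharZero.eq_neg_self_iff, ← tsum_neg]
    conv_lhs => rw [← e]
    refine tsum_congr fun p => ?_
    simp only [Equiv.prodCongr_apply, Prod.map, Equiv.refl_apply, Equiv.trans_apply,
      Equiv.neg_apply, Equiv.subRight_apply]
    rw [neg_zpow_sq, neg_zpow_sq, show p.1 + (-p.2 - 1) + 1 = p.1 - p.2 by ring,
      show p.1 - (-p.2 - 1) = p.1 - p.2 + 2 * p.2 + 1 by ring, zpow_add₀ (by norm_num),
      zpow_add₀ (by norm_num), zpow_mul]
    norm_num
    rw [show p.1 - p.2 + 2 * p.2 + 1 = p.1 + p.2 + 1 by ring]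
    ring
  rw [hodd, add_zero]
  refine tsum_congr fun p => ?_
  rw [neg_zpow_sq, neg_zpow_sq, neg_zpow_sq, zpow_sq_pow, zpow_sq_pow, mul_left_comm,
    mul_mul_mul_comm, ← zpow_add₀ hq0, ← zpow_add₀ hq0, ← zpow_add₀ (by norm_num : (-1 : ℂ) ≠ 0)]
  congr 1
  · rw [show p.1 + p.2 = p.1 - p.2 + 2 * p.2 by ring, zpow_add₀ (by norm_num), zpow_mul]
    norm_num
  · congr 1
    push_cast
    ring

/-- The exponent becomes $2a(a+1)+2b^2$ on the even class and $2(a+1)^2+2b(b+1)$ on the odd class,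
so both contribute the same product. -/
theorem psi_sq (hq0 : q ≠ 0) (hq : ‖q‖ < 1) :
    psi q ^ 2 = 2 * phi (q ^ 2) * psi (q ^ 2) := by
  have h := summable_psi hq0 hq
  have h2 := summable_phi (pow_ne_zero 2 hq0) (norm_sq_lt_one hq)
  have h3 := summable_psi (pow_ne_zero 2 hq0) (norm_sq_lt_one hq)
  rw [sq (psi q), psi, ← tsum_mul_tsum_prod h h,
    tsum_prod_int_parity (summable_mul_of_summable_norm h.norm h.norm), two_mul, add_mul]
  congr 1
  · rw [mul_comm, phi, psi, ← tsum_mul_tsum_prod h3 h2]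
    refine tsum_congr fun p => ?_
    rw [zpow_sq_pow, zpow_sq_pow, ← zpow_add₀ hq0, ← zpow_add₀ hq0]
    congr 1
    push_cast
    ring
  · rw [phi, psi, ← tsum_mul_tsum_prod h2 h3,
      ← (Equiv.prodCongr (Equiv.subRight (1 : ℤ)) (Equiv.refl ℤ)).tsum_eq]
    refine tsum_congr fun p => ?_
    simp only [Equiv.prodCongr_apply, Prod.map, Equiv.refl_apply, Equiv.subRight_apply]
    rw [zpow_sq_pow, zpow_sq_pow, ← zpow_add₀ hq0, ← zpow_add₀ hq0]
    congr 1
    push_cast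
    ring

lemma psi_neg (q : ℂ) : psi (-q) = psi q :=
  tsum_congr fun n => (Int.even_mul_succ_self n).neg_zpow q

/-- Split by the parity of the index: $(2n)^2=4n^2$ and $(2n+1)^2=4n(n+1)+1$. -/
theorem phi_eq_add (hq0 : q ≠ 0) (hq : ‖q‖ < 1) : phi q = phi (q ^ 4) + q * psi (q ^ 4) := by
  have h := summable_phi hq0 hq
  let e : ℤ ⊕ ℤ → ℤ := Sum.elim (fun n => 2 * n) (fun n => 2 * n + 1)
  have he : Function.Bijective e := by
    constructor
    · rintro (a | a) (b | b) h <;>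
        simp only [e, Sum.elim_inl, Sum.elim_inr] at h <;>
        first
        | (exfalso; lia)
        | (congr 1; lia)
    · intro a
      rcases Int.even_or_odd' a with ⟨c, h | h⟩
      · exact ⟨.inl c, h.symm⟩
      · exact ⟨.inr c, h.symm⟩
  rw [phi, ← (Equiv.ofBijective e he).tsum_eq]
  have hs := h.comp_injective he.1
  refine (Summable.tsum_sum (f := fun c => q ^ (e c ^ 2)) (hs.comp_injective Sum.inl_injective)
    (hs.comp_injective Sum.inr_injective)).trans ?_
  rw [phi, psi, ← tsum_mul_left]
  congr 1
  · refine tsum_congr fun n => ?_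
    rw [zpow_sq_pow]
    congr 1
    simp only [e, Sum.elim_inl]
    push_cast
    ring
  · refine tsum_congr fun n => ?_
    rw [zpow_sq_pow, ← zpow_one_add₀ hq0]
    congr 1
    simp only [e, Sum.elim_inr]
    push_cast
    ring

lemma phi_neg_ne_zero (hq0 : q ≠ 0) (hq : ‖q‖ < 1) : phi (-q) ≠ 0 := fun h => by
  have := phi_neg_mul_eulerProd hq0 hq
  rw [h, zero_mul] at this
  exact pow_ne_zero 2 (eulerProd_ne_zero hq) this.symm

lemma phi_ne_zero (hq0 : q ≠ 0) (hq : ‖q‖ < 1) : phi q ≠ 0 := by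
  simpa using phi_neg_ne_zero (neg_ne_zero.2 hq0) (by rwa [norm_neg])

/-- Continuity at the origin of series `∑ q ^ (e n)` with nonnegative exponents dominated by a
convergent series. -/
lemma tendsto_tsum_zpow_zero {e : ℤ → ℤ} (he : ∀ n, 0 ≤ e n)
    (hs : ∀ q : ℂ, q ≠ 0 → ‖q‖ < 1 → Summable fun n => q ^ e n) {u : ℕ → ℂ}
    (hu : Tendsto u atTop (𝓝 0)) :
    Tendsto (fun n => ∑' k, u n ^ e k) atTop (𝓝 (∑' k, (0 : ℂ) ^ e k)) := by
  have hh := (hs (1 / 2) (by norm_num) (by norm_num)).norm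
  refine tendsto_tsum_of_dominated_convergence hh (fun k => ?_) ?_
  · lift e k to ℕ using he k with m
    simp only [zpow_natCast]
    exact hu.pow m
  · filter_upwards [hu.norm.eventually (gt_mem_nhds (show ‖(0 : ℂ)‖ < 1 / 2 by norm_num))]
      with n hn k
    have := he k
    lift e k to ℕ using he k with m
    simp only [zpow_natCast, norm_pow]
    norm_num at hn ⊢
    gcongr

lemma tendsto_phi {u : ℕ → ℂ} (hu : Tendsto u atTop (𝓝 0)) :
    Tendsto (fun n => phi (u n)) atTop (𝓝 1) := by
  have := tendsto_tsum_zpow_zero (fun n => sq_nonneg n) (fun q => summable_phi) hu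
  rwa [tsum_eq_single 0 fun n hn => zero_zpow _ (pow_ne_zero 2 hn), sq, zero_mul, zpow_zero] at this

lemma tendsto_psi {u : ℕ → ℂ} (hu : Tendsto u atTop (𝓝 0)) :
    Tendsto (fun n => psi (u n)) atTop (𝓝 2) := by
  have := tendsto_tsum_zpow_zero (e := fun n => n * (n + 1))
    (fun n => by rcases le_or_gt 0 n with h | h <;> nlinarith) (fun q => summable_psi) hu
  -- Both $n=0$ and $n=-1$ have exponent zero, so the limit is $2$.
  rw [tsum_eq_sum (s := {0, -1}) fun n hn => zero_zpow _ (by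
    simp only [mem_insert, mem_singleton, not_or] at hn
    exact mul_ne_zero hn.1 (by lia))] at this
  norm_num at this
  exact this

lemma tendsto_iterate_sq (hq : ‖q‖ < 1) : Tendsto (fun n : ℕ => q ^ (2 ^ n)) atTop (𝓝 0) :=
  (tendsto_pow_atTop_nhds_zero_of_norm_lt_one hq).comp
    (tendsto_pow_atTop_atTop_of_one_lt one_lt_two)

/-- By `psi_sq` a zero at $q$ propagates to $q^2,q^4,\dots$, contradicting the limit $2$ at the
origin. -/
lemma psi_ne_zero (hq0 : q ≠ 0) (hq : ‖q‖ < 1) : psi q ≠ 0 := by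
  intro h
  have key : ∀ n : ℕ, psi (q ^ (2 ^ n)) = 0 := by
    intro n
    induction n with
    | zero => simpa using h
    | succ n ih =>
      have hqn : ‖q ^ 2 ^ n‖ < 1 := by
        rw [norm_pow]; exact pow_lt_one₀ (norm_nonneg _) hq (by positivity)
      have h1 := psi_sq (pow_ne_zero (2 ^ n) hq0) hqn
      rw [ih, zero_pow two_ne_zero, eq_comm, mul_eq_zero, ← pow_mul, ← pow_succ] at h1
      refine h1.resolve_left (mul_ne_zero two_ne_zero (phi_ne_zero (pow_ne_zero _ hq0) ?_))
      rw [norm_pow]; exact pow_lt_one₀ (norm_nonneg _) hq (by positivity)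
  have := tendsto_psi (tendsto_iterate_sq hq)
  simp only [key] at this
  exact two_ne_zero (tendsto_nhds_unique tendsto_const_nhds this).symm

end

end EtaTheta


namespace EtaTheta

open Filter Topology Finset

noncomputable section

/-! ### The Lambert series of four triangular numbers -/

variable {q : ℂ}

/-- The Lambert series `∑ n q ^ n / (1 - q ^ n)`. -/
def lambert (q : ℂ) : ℂ := ∑' n : ℕ, (n + 1) * q ^ (n + 1) / (1 - q ^ (n + 1))

lemma summable_lambert (hq : ‖q‖ < 1) :
    Summable fun n : ℕ => (n + 1) * q ^ (n + 1) / (1 - q ^ (n + 1)) := by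
  have h := summable_norm_pow_mul_geometric_div_one_sub 1 hq
  have := (summable_nat_add_iff (f := fun n : ℕ => (n : ℂ) ^ 1 * q ^ n / (1 - q ^ n)) 1).2 h
  refine this.congr fun n => ?_
  rw [pow_one, Nat.cast_add_one]

/-- Logarithmic differentiation of the product: the Lambert series is $-q\frac{d}{dq}\log$ of the
Euler product. -/
lemma hasDerivAt_eulerProd (hq0 : q ≠ 0) (hq : ‖q‖ < 1) :
    HasDerivAt eulerProd (-lambert q * eulerProd q / q) q := by
  have hmem : q ∈ Metric.ball (0 : ℂ) 1 := by simpa using hq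
  have hd : DifferentiableAt ℂ eulerProd q :=
    ModularForm.differentiableOn_tprod_one_sub_pow.differentiableAt
      (Metric.isOpen_ball.mem_nhds hmem)
  have hl : ∀ n : ℕ, logDeriv (fun x : ℂ => 1 - x ^ (n + 1)) q =
      -q⁻¹ * ((n + 1) * q ^ (n + 1) / (1 - q ^ (n + 1))) := by
    intro n
    rw [logDeriv_apply, deriv_const_sub, deriv_pow_field]
    simp only [Nat.add_sub_cancel, pow_succ]
    push_cast
    field_simp
  have h1 := logDeriv_tprod_eq_tsum Metric.isOpen_ball hmem
    (f := fun (n : ℕ) (x : ℂ) => 1 - x ^ (n + 1)) (fun n => one_sub_pow_ne_zero hq n)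
    (fun n => by fun_prop) (by simpa only [hl] using (summable_lambert hq).mul_left _)
    ModularForm.multipliableLocallyUniformlyOn_one_sub_pow (eulerProd_ne_zero hq)
  simp only [hl, tsum_mul_left] at h1
  have h2 : deriv eulerProd q = -lambert q * eulerProd q / q := by
    have h3 : deriv eulerProd q / eulerProd q = -q⁻¹ * lambert q := h1
    rw [div_eq_iff (eulerProd_ne_zero hq)] at h3
    rw [h3]
    field_simp
  exact h2 ▸ hd.hasDerivAt

/-- The logarithmic derivative `q d/dq` of `q ↦ phi (-q)`. -/
def phiLogDeriv (q : ℂ) : ℂ := 2 * lambert (q ^ 2) - 2 * lambert q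

lemma eventually_punctured_disc (hq0 : q ≠ 0) (hq : ‖q‖ < 1) :
    ∀ᶠ x in 𝓝 q, x ≠ 0 ∧ ‖x‖ < 1 :=
  (isOpen_ne.eventually_mem hq0).and
    ((isOpen_lt continuous_norm continuous_const).eventually_mem hq)

lemma hasDerivAt_phi_neg (hq0 : q ≠ 0) (hq : ‖q‖ < 1) :
    HasDerivAt (fun x => phi (-x)) (phiLogDeriv q * phi (-q) / q) q := by
  have h1 := hasDerivAt_eulerProd hq0 hq
  have h2 := HasDerivAt.comp (h₂ := eulerProd) (h := fun x => x ^ 2) q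
    (hasDerivAt_eulerProd (pow_ne_zero 2 hq0) (norm_sq_lt_one hq)) (hasDerivAt_pow 2 q)
  have hA := eulerProd_ne_zero (norm_sq_lt_one hq)
  have hA1 := eulerProd_ne_zero hq
  have h3 := (h1.pow 2).div h2 hA
  have he : (fun x => phi (-x)) =ᶠ[𝓝 q] (eulerProd ^ 2) / (eulerProd ∘ fun x => x ^ 2) := by
    filter_upwards [eventually_punctured_disc hq0 hq] with x hx
    rw [Pi.div_apply, Pi.pow_apply, Function.comp_apply, ← phi_neg_mul_eulerProd hx.1 hx.2,
      mul_div_cancel_right₀ _ (eulerProd_ne_zero (norm_sq_lt_one hx.2))]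
  refine (h3.congr_of_eventuallyEq he).congr_deriv ?_
  rw [eq_div_of_mul_eq hA (phi_neg_mul_eulerProd hq0 hq), phiLogDeriv]
  simp only [Pi.pow_apply, Function.comp_apply]
  push_cast
  field_simp
  ring

lemma hasDerivAt_phi (hq0 : q ≠ 0) (hq : ‖q‖ < 1) :
    HasDerivAt phi (phiLogDeriv (-q) * phi q / q) q := by
  have h := (hasDerivAt_phi_neg (neg_ne_zero.2 hq0) (by rwa [norm_neg])).comp q
    (hasDerivAt_neg q)
  simp only [neg_neg, Function.comp_def] at h
  exact h.congr_deriv (by field_simp)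

/-- The odd part of the Lambert series. -/
def lambertOdd (q : ℂ) : ℂ := lambert q - lambert (-q)

lemma phi_neg_sq (hq0 : q ≠ 0) (hq : ‖q‖ < 1) :
    phi (-q) ^ 2 = phi (q ^ 2) ^ 2 - q * psi (q ^ 2) ^ 2 := by
  have := phi_sq (neg_ne_zero.2 hq0) (by rwa [norm_neg])
  rw [neg_sq] at this
  rw [this]
  ring

/-- Differentiate $\varphi(q)^2+\varphi(-q)^2=2\varphi(q^2)^2$ and
$\varphi(q)\varphi(-q)=\varphi(-q^2)^2$ and combine. The logarithmic derivatives of $\varphi(q)$ and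
$\varphi(-q)$ share the term in $q^2$, so their difference is twice the odd Lambert part. -/
lemma lambertOdd_sq_mul_phi (hq0 : q ≠ 0) (hq : ‖q‖ < 1) :
    4 * lambertOdd (q ^ 2) * phi (q ^ 2) ^ 2 = q * lambertOdd q * psi (q ^ 2) ^ 2 := by
  have hq2 := pow_ne_zero 2 hq0
  have hn2 := norm_sq_lt_one hq
  have d1 := hasDerivAt_phi hq0 hq
  have d2 := hasDerivAt_phi_neg hq0 hq
  have d3 := HasDerivAt.comp (h₂ := phi) (h := fun x => x ^ 2) q
    (hasDerivAt_phi hq2 hn2) (hasDerivAt_pow 2 q)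
  have d4 := HasDerivAt.comp (h₂ := fun x => phi (-x)) (h := fun x => x ^ 2) q
    (hasDerivAt_phi_neg hq2 hn2) (hasDerivAt_pow 2 q)
  have e1 : phi ^ 2 + (fun x => phi (-x)) ^ 2 =ᶠ[𝓝 q]
      fun x => 2 * ((phi ∘ fun x => x ^ 2) ^ 2) x := by
    filter_upwards [eventually_punctured_disc hq0 hq] with x hx
    simp only [Pi.add_apply, Pi.pow_apply, Function.comp_apply]
    rw [phi_neg_sq hx.1 hx.2, phi_sq hx.1 hx.2]
    ring
  have e2 : phi * (fun x => phi (-x)) =ᶠ[𝓝 q]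
      ((fun x => phi (-x)) ∘ fun x => x ^ 2) ^ 2 := by
    filter_upwards [eventually_punctured_disc hq0 hq] with x hx
    exact phi_mul_phi_neg hx.1 hx.2
  have r1 := ((d1.pow 2).add (d2.pow 2)).unique
    (((d3.pow 2).const_mul 2).congr_of_eventuallyEq e1)
  have r2 := (d1.mul d2).unique ((d4.pow 2).congr_of_eventuallyEq e2)
  simp only [Function.comp_apply] at r1 r2
  have i2 := phi_mul_phi_neg hq0 hq
  have i1 := phi_sq hq0 hq
  have i1' := phi_neg_sq hq0 hq
  have n1 := phi_ne_zero hq0 hq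
  have n2 := phi_neg_ne_zero hq0 hq
  have r1' : 4 * phiLogDeriv (-q ^ 2) * phi (q ^ 2) ^ 2 =
      phiLogDeriv (-q) * phi q ^ 2 + phiLogDeriv q * phi (-q) ^ 2 := by
    field_simp at r1
    push_cast at r1
    refine mul_left_cancel₀ hq0 ?_
    linear_combination (-1) * r1
  have r2' : phiLogDeriv (-q) + phiLogDeriv q = 4 * phiLogDeriv (q ^ 2) := by
    field_simp at r2
    push_cast at r2
    refine mul_left_cancel₀ (mul_ne_zero hq0 (mul_ne_zero n1 n2)) ?_
    linear_combination r2 - 4 * q * phiLogDeriv (q ^ 2) * i2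
  have t1 : phiLogDeriv (-q) - phiLogDeriv q = 2 * lambertOdd q := by
    rw [phiLogDeriv, phiLogDeriv, lambertOdd, neg_sq]; ring
  have t2 : phiLogDeriv (-q ^ 2) - phiLogDeriv (q ^ 2) = 2 * lambertOdd (q ^ 2) := by
    rw [phiLogDeriv, phiLogDeriv, lambertOdd, neg_sq]; ring
  linear_combination (-2 * phi (q ^ 2) ^ 2) * t2 + (1 / 2) * r1' +
    (1 / 2) * phi (q ^ 2) ^ 2 * r2' + (1 / 2) * phiLogDeriv (-q) * i1 +
    (1 / 2) * phiLogDeriv q * i1' + (1 / 2) * q * psi (q ^ 2) ^ 2 * t1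

/-- Equivalently, `lambertOdd q / (q * psi q ^ 4)` is unchanged by $q\mapsto q^2$. -/
lemma lambertOdd_sq (hq0 : q ≠ 0) (hq : ‖q‖ < 1) :
    lambertOdd (q ^ 2) * psi q ^ 4 = q * lambertOdd q * psi (q ^ 2) ^ 4 := by
  have h := lambertOdd_sq_mul_phi hq0 hq
  have h2 : psi q ^ 4 = 4 * phi (q ^ 2) ^ 2 * psi (q ^ 2) ^ 2 := by
    rw [show psi q ^ 4 = (psi q ^ 2) ^ 2 by ring, psi_sq hq0 hq]; ring
  rw [h2]
  linear_combination psi (q ^ 2) ^ 2 * h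

lemma norm_natCast_add_one (k : ℕ) : ‖(k : ℂ) + 1‖ = k + 1 := by
  rw [← Nat.cast_add_one, Complex.norm_natCast, Nat.cast_add_one]

lemma tendsto_lambert_div {u : ℕ → ℂ} (hu0 : ∀ n, u n ≠ 0) (hu : Tendsto u atTop (𝓝 0)) :
    Tendsto (fun n => lambert (u n) / u n) atTop (𝓝 1) := by
  have h1 : ∀ n, lambert (u n) / u n = ∑' k : ℕ, (k + 1) * u n ^ k / (1 - u n ^ (k + 1)) := by
    intro n
    rw [lambert, div_eq_mul_inv, ← tsum_mul_right]
    refine tsum_congr fun k => ?_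
    have := hu0 n
    rw [pow_succ]
    field_simp
  have h2 : (1 : ℂ) = ∑' k : ℕ, (k + 1) * (0 : ℂ) ^ k / (1 - 0 ^ (k + 1)) := by
    rw [tsum_eq_single 0 fun n hn => by simp [hn]]
    simp
  simp only [h1]
  suffices h : Tendsto (fun n => ∑' k : ℕ, ((k : ℂ) + 1) * u n ^ k / (1 - u n ^ (k + 1))) atTop
      (𝓝 (∑' k : ℕ, ((k : ℂ) + 1) * (0 : ℂ) ^ k / (1 - 0 ^ (k + 1)))) by rwa [← h2] at h
  -- The dominating series on $|u|<1/2$; the factor $2$ comes from $|1-u^{k+1}|\ge 1/2$.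
  have hs : Summable fun k : ℕ => ((k : ℝ) + 1) * (1 / 2) ^ k * 2 := by
    have := (summable_nat_add_iff (f := fun n : ℕ => (n : ℝ) ^ 1 * (1 / 2) ^ n) 1).2
      (summable_pow_mul_geometric_of_norm_lt_one 1 (show ‖(1 / 2 : ℝ)‖ < 1 by norm_num))
    refine (this.mul_right 4).congr fun k => ?_
    push_cast
    rw [pow_succ]
    ring
  refine tendsto_tsum_of_dominated_convergence hs (fun k => ?_) ?_
  · have h3 : Tendsto (fun n => ((k : ℂ) + 1) * u n ^ k) atTop (𝓝 ((k + 1) * 0 ^ k)) :=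
      (hu.pow k).const_mul _
    have h4 : Tendsto (fun n => 1 - u n ^ (k + 1)) atTop (𝓝 (1 - 0 ^ (k + 1))) :=
      (hu.pow (k + 1)).const_sub 1
    exact h3.div h4 (by rw [zero_pow k.succ_ne_zero, sub_zero]; exact one_ne_zero)
  · have hev : ∀ᶠ n in atTop, ‖u n‖ < 1 / 2 :=
      hu.norm.eventually (gt_mem_nhds (show ‖(0 : ℂ)‖ < 1 / 2 by norm_num))
    filter_upwards [hev] with n hn k
    have h3 : (1 / 2 : ℝ) ≤ ‖1 - u n ^ (k + 1)‖ := by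
      have := norm_sub_norm_le (1 : ℂ) (u n ^ (k + 1))
      rw [norm_one, norm_pow] at this
      have h4 : ‖u n‖ ^ (k + 1) ≤ ‖u n‖ := pow_le_of_le_one (norm_nonneg _) (by linarith)
        k.succ_ne_zero
      linarith
    rw [norm_div, norm_mul, norm_pow, div_le_iff₀ (by linarith)]
    rw [norm_natCast_add_one]
    calc ((k : ℝ) + 1) * ‖u n‖ ^ k ≤ (k + 1) * (1 / 2) ^ k := by gcongr
      _ = (k + 1) * (1 / 2) ^ k * 2 * (1 / 2) := by ring
      _ ≤ _ := by gcongr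

/-- **Legendre's theorem on sums of four triangular numbers**, in Lambert series form. -/
theorem lambertOdd_eq (hq0 : q ≠ 0) (hq : ‖q‖ < 1) : lambertOdd q = q * psi q ^ 4 / 8 := by
  have hn : ∀ n : ℕ, ‖q ^ 2 ^ n‖ < 1 := fun n => by
    rw [norm_pow]; exact pow_lt_one₀ (norm_nonneg _) hq (by positivity)
  have h0 : ∀ n : ℕ, q ^ 2 ^ n ≠ 0 := fun n => pow_ne_zero _ hq0
  have key : ∀ n : ℕ, lambertOdd (q ^ 2 ^ n) / (q ^ 2 ^ n) / psi (q ^ 2 ^ n) ^ 4 =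
      lambertOdd q / q / psi q ^ 4 := by
    intro n
    induction n with
    | zero => simp
    | succ n ih =>
      have h := lambertOdd_sq (h0 n) (hn n)
      rw [← ih, pow_succ 2 n, pow_mul]
      have := psi_ne_zero (h0 n) (hn n)
      have := psi_ne_zero (pow_ne_zero 2 (h0 n)) (norm_sq_lt_one (hn n))
      have := h0 n
      field_simp
      linear_combination h
  have hu := tendsto_iterate_sq hq
  have hu' : Tendsto (fun n : ℕ => -q ^ 2 ^ n) atTop (𝓝 0) := by simpa using hu.neg
  -- The odd part divided by $u$ is `lambert u / u + lambert (-u) / (-u)`, which tends to $2$; with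
  -- $\psi^4\to16$ the invariant quotient is $1/8$.
  have t1 := (tendsto_lambert_div h0 hu).add
    (tendsto_lambert_div (fun n => neg_ne_zero.2 (h0 n)) hu')
  have t2 := t1.div ((tendsto_psi hu).pow 4) (by norm_num)
  have t3 := tendsto_nhds_unique (t2.congr fun n => ?_) (tendsto_const_nhds (x := lambertOdd q / q / psi q ^ 4))
  · have := psi_ne_zero hq0 hq
    field_simp at t3
    norm_num at t3
    linear_combination (-1 / 16) * t3
  · rw [← key n]
    simp only [Pi.div_apply]
    rw [lambertOdd, div_neg]
    ring

lemma summable_lambert_prod {x : ℝ} (hx0 : 0 ≤ x) (hx : x < 1) :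
    Summable fun p : ℕ × ℕ => ((p.2 : ℝ) + 1) * x ^ ((p.1 + 1) * (p.2 + 1)) := by
  have h1 := summable_geometric_of_lt_one hx0 hx
  have h2 : Summable fun k : ℕ => ((k : ℝ) + 1) * x ^ k := by
    have := (summable_pow_mul_geometric_of_norm_lt_one 1
      (show ‖x‖ < 1 by rwa [Real.norm_of_nonneg hx0])).add h1
    refine this.congr fun k => ?_
    ring
  refine Summable.of_nonneg_of_le (fun p => by positivity) (fun p => ?_)
    (h1.mul_of_nonneg h2 (fun k => by positivity) fun k => by positivity)
  rw [mul_left_comm, ← pow_add]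
  gcongr 1
  exact pow_le_pow_of_le_one hx0 hx.le (by nlinarith)

lemma hasSum_lambert (hq : ‖q‖ < 1) :
    HasSum (fun p : ℕ × ℕ => ((p.2 : ℂ) + 1) * q ^ ((p.1 + 1) * (p.2 + 1))) (lambert q) := by
  have hs : Summable fun p : ℕ × ℕ => ((p.2 : ℂ) + 1) * q ^ ((p.1 + 1) * (p.2 + 1)) := by
    refine Summable.of_norm ((summable_lambert_prod (norm_nonneg q) hq).congr fun p => ?_)
    rw [norm_mul, norm_pow, norm_natCast_add_one]
  convert hs.hasSum using 1
  have hs' : Summable fun p : ℕ × ℕ => ((p.1 : ℂ) + 1) * q ^ ((p.2 + 1) * (p.1 + 1)) :=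
    (Equiv.prodComm ℕ ℕ).summable_iff.2 hs
  rw [← (Equiv.prodComm ℕ ℕ).tsum_eq]
  simp only [Equiv.prodComm_apply, Prod.fst_swap, Prod.snd_swap]
  rw [hs'.tsum_prod, lambert]
  refine tsum_congr fun n => ?_
  have hn : ‖q ^ (n + 1)‖ < 1 := by
    rw [norm_pow]; exact pow_lt_one₀ (norm_nonneg _) hq n.succ_ne_zero
  have : ∀ m : ℕ, ((n : ℂ) + 1) * q ^ ((m + 1) * (n + 1)) =
      ((n : ℂ) + 1) * q ^ (n + 1) * (q ^ (n + 1)) ^ m := fun m => by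
    rw [mul_assoc, ← pow_mul, ← pow_add]; congr 2; ring
  simp only [this]
  rw [tsum_mul_left, tsum_geometric_of_norm_lt_one hn, div_eq_mul_inv]

/-- The character twist of the divisor sum Lambert series is a fourth power. -/
theorem hasSum_twisted_lambert (hq0 : q ≠ 0) (hq : ‖q‖ < 1) :
    HasSum (fun p : ℕ × ℕ => (-1 : ℂ) ^ (p.1 + p.2) * (2 * p.2 + 1) *
      q ^ ((2 * p.1 + 1) * (2 * p.2 + 1))) (q * (psi (Complex.I * q) / 2) ^ 4) := by
  have hIq : ‖Complex.I * q‖ < 1 := by simpa using hq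
  have h1 := (hasSum_lambert hIq).sub (hasSum_lambert (q := -(Complex.I * q)) (by rwa [norm_neg]))
  rw [← lambertOdd, lambertOdd_eq (mul_ne_zero Complex.I_ne_zero hq0) hIq] at h1
  have hinj : Function.Injective fun p : ℕ × ℕ => (2 * p.1, 2 * p.2) := by
    rintro ⟨a, b⟩ ⟨c, d⟩ h
    simp only [Prod.mk.injEq] at h ⊢
    lia
  -- Terms of `lambert x - lambert (-x)` with even exponent cancel, so only pairs of odd factors
  -- survive. At $x=iq$ they carry $i^{(2m+1)(2n+1)}=(-1)^{m+n}i$, and dividing by $2i$ normalizes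
  -- the sum.
  rw [← hinj.hasSum_iff] at h1
  · have h2 := h1.mul_left (1 / (2 * Complex.I))
    have h3 : 1 / (2 * Complex.I) * (Complex.I * q * psi (Complex.I * q) ^ 4 / 8) =
        q * (psi (Complex.I * q) / 2) ^ 4 := by
      have := Complex.I_ne_zero
      field_simp
      ring
    rw [← h3]
    refine h2.congr_fun fun p => ?_
    have h4 : (2 * p.1 + 1) * (2 * p.2 + 1) = 2 * (2 * (p.1 * p.2) + (p.1 + p.2)) + 1 := by ring
    have h5 : Complex.I ^ ((2 * p.1 + 1) * (2 * p.2 + 1)) = (-1) ^ (p.1 + p.2) * Complex.I := by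
      rw [h4, pow_succ, pow_mul, Complex.I_sq, pow_add _ (2 * _), pow_mul]
      norm_num
    have h6 : Odd ((2 * p.1 + 1) * (2 * p.2 + 1)) := ⟨_, h4⟩
    simp only [Function.comp_apply]
    rw [h6.neg_pow, mul_pow, h5]
    have := Complex.I_ne_zero
    field_simp
    push_cast
    ring
  · rintro ⟨a, b⟩ hp
    have : Even ((a + 1) * (b + 1)) := by
      rw [Nat.even_mul]
      by_contra! hcon
      simp only [Nat.not_even_iff_odd] at hcon
      obtain ⟨⟨c, hc⟩, ⟨d, hd⟩⟩ := hcon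
      exact hp ⟨(c, d), by simp only [Prod.mk.injEq]; lia⟩
    rw [this.neg_pow, sub_self]

end

end EtaTheta


namespace EtaTheta

open MeasureTheory Set Real

noncomputable section

/-! ### The Cauchy–Schlömilch substitution -/

section CauchySchlomilch

variable {α β : ℝ}

/-- The positive root of `α v ^ 2 - u v - β`. -/
def posRoot (α β u : ℝ) : ℝ := (u + √(u ^ 2 + 4 * α * β)) / (2 * α)

lemma posRoot_pos (hα : 0 < α) (hβ : 0 < β) (u : ℝ) : 0 < posRoot α β u := by
  have : |u| < √(u ^ 2 + 4 * α * β) := by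
    rw [← Real.sqrt_sq_eq_abs]
    exact Real.sqrt_lt_sqrt (sq_nonneg u) (by nlinarith [mul_pos hα hβ])
  have := neg_abs_le u
  exact div_pos (by linarith) (by linarith)

lemma posRoot_spec (hα : 0 < α) (hβ : 0 < β) (u : ℝ) :
    α * posRoot α β u - β / posRoot α β u = u := by
  have h := posRoot_pos hα hβ u
  have hs := Real.sq_sqrt (show 0 ≤ u ^ 2 + 4 * α * β by nlinarith [mul_pos hα hβ, sq_nonneg u])
  have h2 : α * posRoot α β u ^ 2 = u * posRoot α β u + β := by
    rw [posRoot]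
    set R := √(u ^ 2 + 4 * α * β)
    field_simp
    linear_combination hs
  field_simp
  linear_combination h2

lemma injOn_sub_div (hα : 0 < α) (hβ : 0 < β) :
    InjOn (fun x => α * x - β / x) (Ioi 0) := by
  intro x (hx : 0 < x) y (hy : 0 < y) h
  have h1 : (x - y) * (α + β / (x * y)) = 0 := by
    simp only at h
    field_simp at h ⊢
    linear_combination h
  have h2 : 0 < α + β / (x * y) := by positivity
  exact sub_eq_zero.1 ((mul_eq_zero.1 h1).resolve_right h2.ne')

lemma posRoot_sub_div (hα : 0 < α) (hβ : 0 < β) {x : ℝ} (hx : 0 < x) :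
    posRoot α β (α * x - β / x) = x :=
  injOn_sub_div hα hβ (posRoot_pos hα hβ _) hx (posRoot_spec hα hβ _)

/-- The substitution `u = α x - β / x` from the positive half-line to the real line. -/
lemma integral_eq_integral_Ioi_sub_div (hα : 0 < α) (hβ : 0 < β) (g : ℝ → ℝ) :
    ∫ u, g u = ∫ x in Ioi 0, (α + β / x ^ 2) * g (α * x - β / x) := by
  have himg : (fun x => α * x - β / x) '' Ioi 0 = univ :=
    eq_univ_of_forall fun u => ⟨posRoot α β u, posRoot_pos hα hβ u, posRoot_spec hα hβ u⟩
  have hd : ∀ x ∈ Ioi (0 : ℝ), HasDerivWithinAt (fun x => α * x - β / x) (α + β / x ^ 2)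
      (Ioi 0) x := by
    intro x (hx : 0 < x)
    have h1 := ((hasDerivAt_id x).const_mul α).sub ((hasDerivAt_inv hx.ne').const_mul β)
    refine (h1.congr_deriv (by field_simp; ring)).hasDerivWithinAt
  rw [← setIntegral_univ, ← himg,
    integral_image_eq_integral_abs_deriv_smul measurableSet_Ioi hd (injOn_sub_div hα hβ)]
  refine setIntegral_congr_fun measurableSet_Ioi fun x (hx : 0 < x) => ?_
  simp only [smul_eq_mul]
  rw [abs_of_pos (by positivity)]

lemma hasDerivAt_posRoot (hα : 0 < α) (hβ : 0 < β) (u : ℝ) :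
    HasDerivAt (posRoot α β) (posRoot α β u / √(u ^ 2 + 4 * α * β)) u := by
  have hp : 0 < u ^ 2 + 4 * α * β := by nlinarith [mul_pos hα hβ, sq_nonneg u]
  have h1 := ((hasDerivAt_pow 2 u).add_const (4 * α * β)).sqrt hp.ne'
  have h2 := ((hasDerivAt_id u).add h1).div_const (2 * α)
  refine h2.congr_deriv ?_
  have := Real.sqrt_pos.2 hp
  rw [posRoot]
  field_simp
  push_cast
  ring

/-- The integral representation of the modified Bessel function `K_{1/2}`. -/
lemma integral_inv_sqrt_mul_exp (hα : 0 < α) (hβ : 0 < β) :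
    ∫ y in Ioi 0, (√y)⁻¹ * exp (-α ^ 2 * y - β ^ 2 / y) = √π / α * exp (-(2 * α * β)) := by
  set R : ℝ → ℝ := fun u => √(u ^ 2 + 4 * α * β) with hR
  have hp : ∀ u : ℝ, 0 < u ^ 2 + 4 * α * β := fun u => by
    nlinarith [mul_pos hα hβ, sq_nonneg u]
  have hRpos : ∀ u, 0 < R u := fun u => Real.sqrt_pos.2 (hp u)
  have hv := posRoot_pos hα hβ
  -- Substitute $y=v^2$ with $\alpha v-\beta/v=u$, which completes the square:
  -- $\alpha^2y+\beta^2/y=u^2+2\alpha\beta$.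
  have himg : (fun u => posRoot α β u ^ 2) '' univ = Ioi 0 := by
    ext y
    simp only [image_univ, mem_range, mem_Ioi]
    constructor
    · rintro ⟨u, rfl⟩
      exact pow_pos (hv u) 2
    · intro hy
      exact ⟨α * √y - β / √y, by
        rw [posRoot_sub_div hα hβ (Real.sqrt_pos.2 hy), Real.sq_sqrt hy.le]⟩
  have hinj : InjOn (fun u => posRoot α β u ^ 2) univ := by
    intro u _ v _ h
    have h1 : posRoot α β u = posRoot α β v :=
      (pow_left_inj₀ (hv u).le (hv v).le two_ne_zero).1 h
    rw [← posRoot_spec hα hβ u, h1, posRoot_spec hα hβ v]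
  have hd : ∀ u ∈ (univ : Set ℝ), HasDerivWithinAt (fun u => posRoot α β u ^ 2)
      (2 * posRoot α β u ^ 2 / R u) univ u := by
    intro u _
    refine (((hasDerivAt_posRoot hα hβ u).pow 2).congr_deriv ?_).hasDerivWithinAt
    push_cast
    ring
  rw [← himg, integral_image_eq_integral_abs_deriv_smul MeasurableSet.univ hd hinj,
    setIntegral_univ]
  -- The Jacobian divided by $\sqrt y$ is $2v/R=(1+u/R)/\alpha$. The $u/R$ part is odd and
  -- integrates to zero, leaving a Gaussian.
  have h1 : ∀ u, |2 * posRoot α β u ^ 2 / R u| • ((√(posRoot α β u ^ 2))⁻¹ *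
      exp (-α ^ 2 * posRoot α β u ^ 2 - β ^ 2 / posRoot α β u ^ 2)) =
      exp (-(2 * α * β)) / α * (exp (-1 * u ^ 2) + u / R u * exp (-1 * u ^ 2)) := by
    intro u
    have h2 := hv u
    have h3 := hRpos u
    rw [abs_of_pos (by positivity), Real.sqrt_sq h2.le, smul_eq_mul]
    have h4 : -α ^ 2 * posRoot α β u ^ 2 - β ^ 2 / posRoot α β u ^ 2 =
        -(2 * α * β) + -1 * u ^ 2 := by
      conv_rhs => rw [← posRoot_spec hα hβ u]
      field_simp
      ring
    rw [h4, Real.exp_add]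
    have h5 : 2 * α * posRoot α β u = u + R u := by
      rw [posRoot, mul_div_cancel₀ _ (by positivity)]
    field_simp
    linear_combination h5
  simp only [h1]
  have hg : Integrable fun u : ℝ => exp (-1 * u ^ 2) := integrable_exp_neg_mul_sq one_pos
  have hcont : Continuous fun u => u / R u :=
    continuous_id.div (by fun_prop) fun u => (hRpos u).ne'
  have hbd : ∀ u, ‖u / R u‖ ≤ 1 := by
    intro u
    rw [norm_div, Real.norm_eq_abs, Real.norm_of_nonneg (hRpos u).le, div_le_one (hRpos u),
      ← Real.sqrt_sq_eq_abs]
    exact Real.sqrt_le_sqrt (by nlinarith [mul_pos hα hβ])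
  have hg2 : Integrable fun u : ℝ => u / R u * exp (-1 * u ^ 2) :=
    hg.bdd_mul hcont.aestronglyMeasurable (Filter.Eventually.of_forall hbd)
  have hodd : ∫ u, u / R u * exp (-1 * u ^ 2) = 0 := by
    have h := integral_neg_eq_self (fun u => u / R u * exp (-1 * u ^ 2)) volume
    have h2 : ∀ u : ℝ, -u / R (-u) * exp (-1 * (-u) ^ 2) = -(u / R u * exp (-1 * u ^ 2)) := by
      intro u
      simp only [hR, neg_sq]
      ring
    simp only [h2, integral_neg] at h
    linarith
  rw [integral_const_mul, integral_add hg hg2, hodd, integral_gaussian]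
  simp only [add_zero, div_one]
  ring

end CauchySchlomilch

/-! ### The complete elliptic integral and the arithmetic-geometric mean -/

/-- The symmetric form of the complete elliptic integral of the first kind. -/
def gaussIntegral (a b : ℝ) : ℝ := ∫ t in Ioi 0, (√((t ^ 2 + a ^ 2) * (t ^ 2 + b ^ 2)))⁻¹

lemma integrableOn_gaussIntegral {a b : ℝ} (ha : 0 < a) (hb : 0 < b) :
    IntegrableOn (fun t => (√((t ^ 2 + a ^ 2) * (t ^ 2 + b ^ 2)))⁻¹) (Ioi 0) := by
  -- Chosen so that both quadratic factors dominate $m^2(1+t^2)$, for comparison with $1/(1+t^2)$.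
  obtain ⟨m, hm0, hm1, hma, hmb⟩ : ∃ m : ℝ, 0 < m ∧ m ≤ 1 ∧ m ≤ a ∧ m ≤ b :=
    ⟨min 1 (min a b), by positivity, by simp, by simp, by simp⟩
  refine Integrable.mono' ((integrable_inv_one_add_sq.const_mul (m ^ 2)⁻¹).integrableOn)
    (Continuous.aestronglyMeasurable ?_) (Filter.Eventually.of_forall fun t => ?_)
  · exact Continuous.inv₀ (by fun_prop) fun t => by positivity
  · rw [Real.norm_of_nonneg (by positivity), ← mul_inv]
    refine inv_anti₀ (by positivity) (Real.le_sqrt_of_sq_le ?_)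
    have h0 : m ^ 2 ≤ 1 := pow_le_one₀ hm0.le hm1
    have h1 : m ^ 2 * (1 + t ^ 2) ≤ t ^ 2 + a ^ 2 := by
      nlinarith [sq_nonneg t, pow_le_pow_left₀ hm0.le hma 2]
    have h2 : m ^ 2 * (1 + t ^ 2) ≤ t ^ 2 + b ^ 2 := by
      nlinarith [sq_nonneg t, pow_le_pow_left₀ hm0.le hmb 2]
    rw [sq (m ^ 2 * (1 + t ^ 2))]
    gcongr

lemma gaussIntegral_anti {a b a' b' : ℝ} (ha : 0 < a) (hb : 0 < b) (ha' : a ≤ a') (hb' : b ≤ b') :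
    gaussIntegral a' b' ≤ gaussIntegral a b := by
  refine setIntegral_mono_on (integrableOn_gaussIntegral (ha.trans_le ha') (hb.trans_le hb'))
    (integrableOn_gaussIntegral ha hb) measurableSet_Ioi fun t _ => ?_
  refine inv_anti₀ (by positivity) (Real.sqrt_le_sqrt ?_)
  gcongr

lemma gaussIntegral_strictAnti {a b b' : ℝ} (ha : 0 < a) (hb : 0 < b) (hb' : b < b') :
    gaussIntegral a b' < gaussIntegral a b := by
  have i1 := integrableOn_gaussIntegral ha hb
  have i2 := integrableOn_gaussIntegral ha (hb.trans hb')
  have hpos : ∀ t : ℝ, 0 < (√((t ^ 2 + a ^ 2) * (t ^ 2 + b ^ 2)))⁻¹ -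
      (√((t ^ 2 + a ^ 2) * (t ^ 2 + b' ^ 2)))⁻¹ := by
    intro t
    refine sub_pos.2 (inv_strictAnti₀ (by positivity) (Real.sqrt_lt_sqrt (by positivity) ?_))
    gcongr
  rw [← sub_pos, gaussIntegral, gaussIntegral, ← integral_sub i1 i2,
    setIntegral_pos_iff_support_of_nonneg_ae (Filter.Eventually.of_forall fun t => (hpos t).le)
      (i1.sub i2)]
  have : Function.support (fun t : ℝ => (√((t ^ 2 + a ^ 2) * (t ^ 2 + b ^ 2)))⁻¹ -
      (√((t ^ 2 + a ^ 2) * (t ^ 2 + b' ^ 2)))⁻¹) = univ :=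
    eq_univ_of_forall fun t => (hpos t).ne'
  rw [this, univ_inter]
  simp

lemma gaussIntegral_mul {c : ℝ} (hc : 0 < c) (a b : ℝ) :
    gaussIntegral (c * a) (c * b) = gaussIntegral a b / c := by
  have h := integral_comp_mul_left_Ioi
    (fun t => (√((t ^ 2 + (c * a) ^ 2) * (t ^ 2 + (c * b) ^ 2)))⁻¹) 0 hc
  rw [mul_zero, smul_eq_mul, ← gaussIntegral] at h
  have h2 : ∀ t : ℝ, (√(((c * t) ^ 2 + (c * a) ^ 2) * ((c * t) ^ 2 + (c * b) ^ 2)))⁻¹ =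
      (c ^ 2)⁻¹ * (√((t ^ 2 + a ^ 2) * (t ^ 2 + b ^ 2)))⁻¹ := by
    intro t
    rw [← mul_inv, show ((c * t) ^ 2 + (c * a) ^ 2) * ((c * t) ^ 2 + (c * b) ^ 2) =
      (c ^ 2) ^ 2 * ((t ^ 2 + a ^ 2) * (t ^ 2 + b ^ 2)) by ring,
      Real.sqrt_mul (by positivity), Real.sqrt_sq (by positivity)]
  simp only [h2] at h
  rw [integral_const_mul, ← gaussIntegral] at h
  field_simp at h ⊢
  linear_combination -h

lemma gaussIntegral_self {m : ℝ} (hm : 0 < m) : gaussIntegral m m = π / 2 / m := by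
  have h1 : gaussIntegral 1 1 = π / 2 := by
    have h := integral_Ioi_inv_one_add_sq (i := 0)
    rw [Real.arctan_zero, sub_zero] at h
    rw [gaussIntegral, ← h]
    refine setIntegral_congr_fun measurableSet_Ioi fun t _ => ?_
    rw [← sq, Real.sqrt_sq (by positivity)]
    ring
  have := gaussIntegral_mul hm 1 1
  rwa [mul_one, h1] at this

/-- **Gauss's transformation**: invariance under arithmetic and geometric means. -/
theorem gaussIntegral_agm {a b g : ℝ} (ha : 0 < a) (hb : 0 < b) (hg : g ^ 2 = a * b) :
    gaussIntegral ((a + b) / 2) g = gaussIntegral a b := by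
  have h1 := integral_comp_abs
    (f := fun u => (√((u ^ 2 + ((a + b) / 2) ^ 2) * (u ^ 2 + g ^ 2)))⁻¹)
  simp only [sq_abs] at h1
  rw [← gaussIntegral, integral_eq_integral_Ioi_sub_div (α := 1 / 2) (β := a * b / 2) (by norm_num)
    (by positivity)] at h1
  have h2 : ∀ x ∈ Ioi (0 : ℝ), (1 / 2 + a * b / 2 / x ^ 2) *
      (√(((1 / 2 * x - a * b / 2 / x) ^ 2 + ((a + b) / 2) ^ 2) *
        ((1 / 2 * x - a * b / 2 / x) ^ 2 + g ^ 2)))⁻¹ =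
      2 * (√((x ^ 2 + a ^ 2) * (x ^ 2 + b ^ 2)))⁻¹ := by
    intro x (hx : 0 < x)
    -- With $u=(x-ab/x)/2$, the factors are $u^2+(\frac{a+b}2)^2=\frac{(x^2+a^2)(x^2+b^2)}{4x^2}$
    -- and $u^2+ab=\frac{(x^2+ab)^2}{4x^2}$; the square root of the latter cancels against the
    -- Jacobian.
    have e : ((1 / 2 * x - a * b / 2 / x) ^ 2 + ((a + b) / 2) ^ 2) *
        ((1 / 2 * x - a * b / 2 / x) ^ 2 + g ^ 2) =
        ((x ^ 2 + a * b) / (4 * x ^ 2)) ^ 2 * ((x ^ 2 + a ^ 2) * (x ^ 2 + b ^ 2)) := by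
      rw [hg]
      field_simp
      ring
    rw [e, Real.sqrt_mul (by positivity), Real.sqrt_sq (by positivity)]
    have : 0 < √((x ^ 2 + a ^ 2) * (x ^ 2 + b ^ 2)) := by positivity
    field_simp
    ring
  rw [setIntegral_congr_fun measurableSet_Ioi h2, integral_const_mul, ← gaussIntegral] at h1
  linarith

/-! ### Legendre's integral in symmetric form, and uniqueness of the singular value -/

lemma complementaryModulus_pos {k : ℝ} (hk0 : 0 < k) (hk1 : k < 1) :
    0 < complementaryModulus k := Real.sqrt_pos.2 (by nlinarith)

lemma complementaryModulus_lt_one {k : ℝ} (hk0 : 0 < k) : complementaryModulus k < 1 := by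
  rw [complementaryModulus, Real.sqrt_lt' one_pos]
  nlinarith

lemma complementaryModulus_sq {k : ℝ} (hk0 : 0 < k) (hk1 : k < 1) :
    complementaryModulus k ^ 2 = 1 - k ^ 2 := Real.sq_sqrt (by nlinarith)

lemma complementaryModulus_eq {k l : ℝ} (hl : 0 ≤ l) (h : k ^ 2 + l ^ 2 = 1) :
    complementaryModulus k = l := by
  rw [complementaryModulus, show 1 - k ^ 2 = l ^ 2 by linarith, Real.sqrt_sq hl]

/-- The substitution is $u=\sin\theta$, $s=k'\tan\theta$, that is $u=s/\sqrt{s^2+k'^2}$. -/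
theorem ellipticK_eq_gaussIntegral {k : ℝ} (hk0 : 0 < k) (hk1 : k < 1) :
    ellipticK k = gaussIntegral 1 (complementaryModulus k) := by
  set c := complementaryModulus k with hc
  have hc0 : 0 < c := complementaryModulus_pos hk0 hk1
  have hk : k ^ 2 = 1 - c ^ 2 := by rw [hc, complementaryModulus_sq hk0 hk1]; ring
  have hpos : ∀ s : ℝ, 0 < s ^ 2 + c ^ 2 := fun s => by positivity
  have himg : (fun s => s / √(s ^ 2 + c ^ 2)) '' Ioi 0 = Ioo 0 1 := by
    ext u
    simp only [mem_image, mem_Ioi, mem_Ioo]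
    constructor
    · rintro ⟨s, hs, rfl⟩
      refine ⟨div_pos hs (Real.sqrt_pos.2 (hpos s)), ?_⟩
      rw [div_lt_one (Real.sqrt_pos.2 (hpos s))]
      exact Real.lt_sqrt_of_sq_lt (by nlinarith)
    · rintro ⟨hu0, hu1⟩
      have h1 : 0 < 1 - u ^ 2 := by nlinarith
      have h2 := Real.sqrt_pos.2 h1
      refine ⟨c * u / √(1 - u ^ 2), by positivity, ?_⟩
      have h3 : (c * u / √(1 - u ^ 2)) ^ 2 + c ^ 2 = (c / √(1 - u ^ 2)) ^ 2 := by
        field_simp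
        rw [Real.sq_sqrt h1.le]
        ring
      rw [h3, Real.sqrt_sq (by positivity)]
      field_simp
  have hd : ∀ s ∈ Ioi (0 : ℝ), HasDerivWithinAt (fun s => s / √(s ^ 2 + c ^ 2))
      (c ^ 2 / ((s ^ 2 + c ^ 2) * √(s ^ 2 + c ^ 2))) (Ioi 0) s := by
    intro s _
    have h0 := Real.sqrt_pos.2 (hpos s)
    have h1 := (hasDerivAt_id s).div (((hasDerivAt_pow 2 s).add_const (c ^ 2)).sqrt (hpos s).ne')
      h0.ne'
    refine (h1.congr_deriv ?_).hasDerivWithinAt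
    have h2 := Real.sq_sqrt (hpos s).le
    have h3 := hpos s
    simp only [id]
    push_cast
    rw [h2]
    field_simp
    rw [h2]
    ring
  have hinj : InjOn (fun s => s / √(s ^ 2 + c ^ 2)) (Ioi 0) := by
    intro x (hx : 0 < x) y (hy : 0 < y) h
    have h1 : (x / √(x ^ 2 + c ^ 2)) ^ 2 = (y / √(y ^ 2 + c ^ 2)) ^ 2 := congrArg (· ^ 2) h
    rw [div_pow, div_pow, Real.sq_sqrt (hpos x).le, Real.sq_sqrt (hpos y).le,
      div_eq_div_iff (hpos x).ne' (hpos y).ne'] at h1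
    have h2 : x ^ 2 = y ^ 2 := by
      have : c ^ 2 * x ^ 2 = c ^ 2 * y ^ 2 := by linear_combination h1
      exact mul_left_cancel₀ (by positivity) this
    exact (pow_left_inj₀ hx.le hy.le two_ne_zero).1 h2
  rw [ellipticK, intervalIntegral.integral_of_le zero_le_one, integral_Ioc_eq_integral_Ioo, ← himg,
    integral_image_eq_integral_abs_deriv_smul measurableSet_Ioi hd hinj, gaussIntegral]
  refine setIntegral_congr_fun measurableSet_Ioi fun s (hs : 0 < s) => ?_
  simp only [smul_eq_mul]
  have h0 := Real.sqrt_pos.2 (hpos s)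
  have h2 := Real.sq_sqrt (hpos s).le
  have h3 := hpos s
  have e : (1 - (s / √(s ^ 2 + c ^ 2)) ^ 2) * (1 - k ^ 2 * (s / √(s ^ 2 + c ^ 2)) ^ 2) =
      (c ^ 2 / (s ^ 2 + c ^ 2)) ^ 2 * (s ^ 2 + 1) := by
    rw [div_pow, h2, hk]
    field_simp
    ring
  rw [e, Real.sqrt_mul (by positivity), Real.sqrt_sq (by positivity), abs_of_pos (by positivity),
    one_pow, Real.sqrt_mul (by positivity)]
  have : 0 < √(s ^ 2 + 1) := by positivity
  field_simp

lemma ellipticK_pos {k : ℝ} (hk0 : 0 < k) (hk1 : k < 1) : 0 < ellipticK k := by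
  rw [ellipticK_eq_gaussIntegral hk0 hk1]
  have h1 := gaussIntegral_anti (complementaryModulus_pos hk0 hk1)
    (complementaryModulus_pos hk0 hk1) (complementaryModulus_lt_one hk0).le
    (complementaryModulus_lt_one hk0).le
  have h2 := gaussIntegral_anti one_pos (complementaryModulus_pos hk0 hk1) le_rfl
    (complementaryModulus_lt_one hk0).le
  rw [gaussIntegral_self one_pos] at h2
  linarith [Real.pi_pos]

lemma ellipticK_strictMono {k l : ℝ} (hk0 : 0 < k) (hkl : k < l) (hl1 : l < 1) :
    ellipticK k < ellipticK l := by
  rw [ellipticK_eq_gaussIntegral hk0 (hkl.trans hl1),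
    ellipticK_eq_gaussIntegral (hk0.trans hkl) hl1]
  refine gaussIntegral_strictAnti one_pos (complementaryModulus_pos (hk0.trans hkl) hl1) ?_
  exact Real.sqrt_lt_sqrt (by nlinarith) (by nlinarith)

/-- As $k$ grows, $K(k)$ strictly increases and $K(k')$ strictly decreases, so their ratio is
injective. -/
lemma isSingularValue_unique {p k l : ℝ} (hk : IsSingularValue p k) (hl : IsSingularValue p l) :
    k = l := by
  have key : ∀ {k l : ℝ}, IsSingularValue p k → IsSingularValue p l → ¬ k < l := by
    rintro k l ⟨hk0, hk1, hk⟩ ⟨hl0, hl1, hl⟩ h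
    have h1 := ellipticK_strictMono hk0 h hl1
    have h2 : complementaryModulus l < complementaryModulus k :=
      Real.sqrt_lt_sqrt (by nlinarith) (by nlinarith)
    have h3 := ellipticK_strictMono (complementaryModulus_pos hl0 hl1) h2
      (complementaryModulus_lt_one hk0)
    have h4 := ellipticK_pos hk0 hk1
    have h5 := ellipticK_pos (complementaryModulus_pos hl0 hl1) (complementaryModulus_lt_one hl0)
    have h6 := div_lt_div₀ h3 h1.le (h5.trans h3).le h4
    rw [hk, hl] at h6
    exact lt_irrefl _ h6
  exact le_antisymm (not_lt.1 (key hl hk)) (not_lt.1 (key hk hl))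

end

end EtaTheta


namespace EtaTheta

open Filter Topology Real

noncomputable section

/-! ### Theta parametrization of the singular values -/

/-- The real theta function `∑ q ^ (n ^ 2)`. -/
def realPhi (q : ℝ) : ℝ := ∑' n : ℤ, q ^ (n ^ 2)

/-- The real theta function `∑ q ^ (n (n + 1))`. -/
def realPsi (q : ℝ) : ℝ := ∑' n : ℤ, q ^ (n * (n + 1))

lemma ofReal_realPhi (q : ℝ) : ((realPhi q : ℝ) : ℂ) = phi q := by
  simp [realPhi, phi, Complex.ofReal_tsum]

lemma ofReal_realPsi (q : ℝ) : ((realPsi q : ℝ) : ℂ) = psi q := by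
  simp [realPsi, psi, Complex.ofReal_tsum]

variable {q : ℝ}

lemma ofReal_ne_zero_and_norm_lt (hq0 : 0 < q) (hq1 : q < 1) : (q : ℂ) ≠ 0 ∧ ‖(q : ℂ)‖ < 1 :=
  ⟨by exact_mod_cast hq0.ne', by rwa [Complex.norm_real, Real.norm_of_nonneg hq0.le]⟩

lemma realPhi_ne_zero (hq0 : 0 < q) (hq1 : q < 1) : realPhi q ≠ 0 := by
  obtain ⟨h1, h2⟩ := ofReal_ne_zero_and_norm_lt hq0 hq1
  have := phi_ne_zero h1 h2
  rw [← ofReal_realPhi] at this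
  exact_mod_cast this

lemma realPhi_neg_ne_zero (hq0 : 0 < q) (hq1 : q < 1) : realPhi (-q) ≠ 0 := by
  obtain ⟨h1, h2⟩ := ofReal_ne_zero_and_norm_lt hq0 hq1
  have := phi_neg_ne_zero h1 h2
  rw [← Complex.ofReal_neg, ← ofReal_realPhi] at this
  exact_mod_cast this

lemma realPsi_ne_zero (hq0 : 0 < q) (hq1 : q < 1) : realPsi q ≠ 0 := by
  obtain ⟨h1, h2⟩ := ofReal_ne_zero_and_norm_lt hq0 hq1
  have := psi_ne_zero h1 h2
  rw [← ofReal_realPsi] at this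
  exact_mod_cast this

lemma realPhi_sq (hq0 : 0 < q) (hq1 : q < 1) :
    realPhi q ^ 2 = realPhi (q ^ 2) ^ 2 + q * realPsi (q ^ 2) ^ 2 := by
  obtain ⟨h1, h2⟩ := ofReal_ne_zero_and_norm_lt hq0 hq1
  have := phi_sq h1 h2
  rw [← Complex.ofReal_pow, ← ofReal_realPhi, ← ofReal_realPhi, ← ofReal_realPsi] at this
  exact_mod_cast this

lemma realPhi_neg_sq (hq0 : 0 < q) (hq1 : q < 1) :
    realPhi (-q) ^ 2 = realPhi (q ^ 2) ^ 2 - q * realPsi (q ^ 2) ^ 2 := by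
  obtain ⟨h1, h2⟩ := ofReal_ne_zero_and_norm_lt hq0 hq1
  have := phi_neg_sq h1 h2
  rw [← Complex.ofReal_pow, ← Complex.ofReal_neg, ← ofReal_realPhi, ← ofReal_realPhi,
    ← ofReal_realPsi] at this
  exact_mod_cast this

lemma realPhi_mul_realPhi_neg (hq0 : 0 < q) (hq1 : q < 1) :
    realPhi q * realPhi (-q) = realPhi (-q ^ 2) ^ 2 := by
  obtain ⟨h1, h2⟩ := ofReal_ne_zero_and_norm_lt hq0 hq1
  have := phi_mul_phi_neg h1 h2
  rw [← Complex.ofReal_pow, ← Complex.ofReal_neg, ← Complex.ofReal_neg, ← ofReal_realPhi,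
    ← ofReal_realPhi, ← ofReal_realPhi] at this
  exact_mod_cast this

lemma realPsi_sq (hq0 : 0 < q) (hq1 : q < 1) :
    realPsi q ^ 2 = 2 * realPhi (q ^ 2) * realPsi (q ^ 2) := by
  obtain ⟨h1, h2⟩ := ofReal_ne_zero_and_norm_lt hq0 hq1
  have := psi_sq h1 h2
  rw [← Complex.ofReal_pow, ← ofReal_realPhi, ← ofReal_realPsi, ← ofReal_realPsi] at this
  exact_mod_cast this

lemma realPhi_eq_add (hq0 : 0 < q) (hq1 : q < 1) :
    realPhi q = realPhi (q ^ 4) + q * realPsi (q ^ 4) := by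
  obtain ⟨h1, h2⟩ := ofReal_ne_zero_and_norm_lt hq0 hq1
  have := phi_eq_add h1 h2
  rw [← Complex.ofReal_pow, ← ofReal_realPhi, ← ofReal_realPhi, ← ofReal_realPsi] at this
  exact_mod_cast this

lemma realPhi_neg_eq_sub (hq0 : 0 < q) (hq1 : q < 1) :
    realPhi (-q) = realPhi (q ^ 4) - q * realPsi (q ^ 4) := by
  obtain ⟨h1, h2⟩ := ofReal_ne_zero_and_norm_lt hq0 hq1
  have := phi_eq_add (neg_ne_zero.2 h1) (by rwa [norm_neg])
  rw [Even.neg_pow (by decide), ← Complex.ofReal_pow, ← Complex.ofReal_neg, ← ofReal_realPhi,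
    ← ofReal_realPhi, ← ofReal_realPsi] at this
  have h3 : realPhi (-q) = realPhi (q ^ 4) + -q * realPsi (q ^ 4) := by exact_mod_cast this
  rw [h3]
  ring

lemma tendsto_realPhi {u : ℕ → ℝ} (hu : Tendsto u atTop (𝓝 0)) :
    Tendsto (fun n => realPhi (u n)) atTop (𝓝 1) := by
  have h1 : Tendsto (fun n => (u n : ℂ)) atTop (𝓝 0) := by
    have h := (Complex.continuous_ofReal.tendsto 0).comp hu
    rw [Complex.ofReal_zero] at h
    exact h
  have h2 := (Complex.continuous_re.tendsto 1).comp (tendsto_phi h1)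
  refine (h2.congr fun n => ?_)
  rw [Function.comp_apply, ← ofReal_realPhi, Complex.ofReal_re]

/-- The pair at $q^2$ consists of the arithmetic and geometric means of the pair at $q$, so Gauss's
transformation applies. -/
lemma gaussIntegral_realPhi_sq (hq0 : 0 < q) (hq1 : q < 1) :
    gaussIntegral (realPhi (q ^ 2) ^ 2) (realPhi (-q ^ 2) ^ 2) =
      gaussIntegral (realPhi q ^ 2) (realPhi (-q) ^ 2) := by
  rw [← gaussIntegral_agm (g := realPhi (-q ^ 2) ^ 2) (a := realPhi q ^ 2)]
  · rw [realPhi_sq hq0 hq1, realPhi_neg_sq hq0 hq1]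
    congr 1
    ring
  · exact sq_pos_of_ne_zero (realPhi_ne_zero hq0 hq1)
  · exact sq_pos_of_ne_zero (realPhi_neg_ne_zero hq0 hq1)
  · rw [← realPhi_mul_realPhi_neg hq0 hq1]
    ring

/-- The arithmetic-geometric mean of the squared theta constants is one. -/
theorem gaussIntegral_realPhi (hq0 : 0 < q) (hq1 : q < 1) :
    gaussIntegral (realPhi q ^ 2) (realPhi (-q) ^ 2) = π / 2 := by
  have hn0 : ∀ n : ℕ, 0 < q ^ 2 ^ n := fun n => by positivity
  have hn1 : ∀ n : ℕ, q ^ 2 ^ n < 1 := fun n => pow_lt_one₀ hq0.le hq1 (by positivity)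
  have key : ∀ n : ℕ, gaussIntegral (realPhi (q ^ 2 ^ n) ^ 2) (realPhi (-q ^ 2 ^ n) ^ 2) =
      gaussIntegral (realPhi q ^ 2) (realPhi (-q) ^ 2) := by
    intro n
    induction n with
    | zero => simp
    | succ n ih => rw [← ih, pow_succ 2 n, pow_mul, gaussIntegral_realPhi_sq (hn0 n) (hn1 n)]
  have hu : Tendsto (fun n : ℕ => q ^ 2 ^ n) atTop (𝓝 0) :=
    (tendsto_pow_atTop_nhds_zero_of_lt_one hq0.le hq1).comp
      (tendsto_pow_atTop_atTop_of_one_lt one_lt_two)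
  have ha := (tendsto_realPhi hu).pow 2
  have hb := (tendsto_realPhi (u := fun n => -q ^ 2 ^ n) (by simpa using hu.neg)).pow 2
  rw [one_pow] at ha hb
  have hapos : ∀ n, 0 < realPhi (q ^ 2 ^ n) ^ 2 := fun n =>
    sq_pos_of_ne_zero (realPhi_ne_zero (hn0 n) (hn1 n))
  have hbpos : ∀ n, 0 < realPhi (-q ^ 2 ^ n) ^ 2 := fun n =>
    sq_pos_of_ne_zero (realPhi_neg_ne_zero (hn0 n) (hn1 n))
  -- The Gauss integral is squeezed between its values at equal arguments, the maximum and the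
  -- minimum of the pair; both arguments tend to $1$.
  have hmin := (ha.min hb)
  have hmax := (ha.max hb)
  rw [min_self] at hmin
  rw [max_self] at hmax
  have hup : Tendsto (fun n : ℕ => π / 2 / min (realPhi (q ^ 2 ^ n) ^ 2) (realPhi (-q ^ 2 ^ n) ^ 2))
      atTop (𝓝 (π / 2 / 1)) := tendsto_const_nhds.div hmin one_ne_zero
  have hlo : Tendsto (fun n : ℕ => π / 2 / max (realPhi (q ^ 2 ^ n) ^ 2) (realPhi (-q ^ 2 ^ n) ^ 2))
      atTop (𝓝 (π / 2 / 1)) := tendsto_const_nhds.div hmax one_ne_zero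
  rw [div_one] at hup hlo
  refine le_antisymm (ge_of_tendsto' hup fun n => ?_) (le_of_tendsto' hlo fun n => ?_)
  · have hm := lt_min (hapos n) (hbpos n)
    rw [← key n, ← gaussIntegral_self hm]
    exact gaussIntegral_anti hm hm (min_le_left _ _) (min_le_right _ _)
  · rw [← key n, ← gaussIntegral_self ((hapos n).trans_le (le_max_left _ _))]
    exact gaussIntegral_anti (hapos n) (hbpos n) (le_max_left _ _) (le_max_right _ _)

/-- The functional equation of the theta function. -/
lemma realPhi_exp_div {y : ℝ} (hy : 0 < y) :
    realPhi (exp (-π / y)) = √y * realPhi (exp (-π * y)) := by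
  have h : ∀ a : ℝ, realPhi (exp (-π * a)) = ∑' n : ℤ, exp (-π * a * (n : ℝ) ^ 2) := by
    intro a
    refine tsum_congr fun n => ?_
    rw [← Real.rpow_intCast, ← Real.exp_mul, Int.cast_pow]
  have h2 := Real.tsum_exp_neg_mul_int_sq hy
  rw [← h, ← Real.sqrt_eq_rpow] at h2
  simp only [div_eq_mul_inv (-π) y, ← h] at h2 ⊢
  rw [h2]
  have := Real.sqrt_pos.2 hy
  field_simp

/-- Write $\varphi(-q)=2\varphi(q^4)-\varphi(q)$ and invert both terms. This leaves $\sqrt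
y\,(\varphi(e^{-\pi y/4})-\varphi(e^{-\pi y}))$, whose bracket is the $\psi$ term of
`realPhi_eq_add`. -/
lemma realPhi_neg_exp_div {y : ℝ} (hy : 0 < y) :
    realPhi (-exp (-π / y)) = √y * (exp (-π * y / 4) * realPsi (exp (-π * y))) := by
  have hlt : ∀ {x : ℝ}, 0 < x → exp (-π * x) < 1 := fun hx => by
    rw [Real.exp_lt_one_iff]
    nlinarith [mul_pos Real.pi_pos hx]
  have h0 : exp (-π / y) = exp (-π * y⁻¹) := by rw [div_eq_mul_inv]
  have h1 := realPhi_eq_add (Real.exp_pos (-π / y)) (by rw [h0]; exact hlt (by positivity))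
  have h2 := realPhi_neg_eq_sub (Real.exp_pos (-π / y)) (by rw [h0]; exact hlt (by positivity))
  have h3 := realPhi_exp_div (show 0 < y / 4 by positivity)
  have h4 := realPhi_eq_add (Real.exp_pos (-π * (y / 4))) (hlt (by positivity))
  have h5 : exp (-π / y) ^ 4 = exp (-π / (y / 4)) := by
    rw [← Real.exp_nat_mul]; congr 1; field_simp; norm_num
  have h6 : exp (-π * (y / 4)) ^ 4 = exp (-π * y) := by
    rw [← Real.exp_nat_mul]; congr 1; field_simp; norm_num
  have h7 : √(y / 4) = √y / 2 := by
    rw [Real.sqrt_div hy.le, show (4 : ℝ) = 2 ^ 2 by norm_num, Real.sqrt_sq two_pos.le]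
  rw [h5] at h1 h2
  rw [h6] at h4
  rw [h7] at h3
  have h8 := realPhi_exp_div hy
  rw [mul_div_assoc]
  linear_combination h2 + h1 - h8 + 2 * h3 + √y * h4

/-- The singular modulus in terms of theta constants. -/
def thetaModulus (y : ℝ) : ℝ :=
  exp (-π * y / 2) * realPsi (exp (-π * y)) ^ 2 / realPhi (exp (-π * y)) ^ 2

lemma exp_neg_pi_mul_lt_one {y : ℝ} (hy : 0 < y) : exp (-π * y) < 1 := by
  rw [Real.exp_lt_one_iff]
  nlinarith [mul_pos Real.pi_pos hy]

section modulus

variable {y : ℝ} (hy : 0 < y)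

include hy

lemma thetaModulus_pos : 0 < thetaModulus y := by
  have h1 := sq_pos_of_ne_zero (realPsi_ne_zero (Real.exp_pos _) (exp_neg_pi_mul_lt_one hy))
  have h2 := sq_pos_of_ne_zero (realPhi_ne_zero (Real.exp_pos _) (exp_neg_pi_mul_lt_one hy))
  exact div_pos (mul_pos (Real.exp_pos _) h1) h2

/-- Jacobi's quartic identity $\varphi(q)^4-\varphi(-q)^4=q\psi(q)^4$: multiply the sum and
difference of $\varphi(\pm q)^2$ and apply `realPsi_sq`. -/
lemma thetaModulus_sq_add :
    thetaModulus y ^ 2 + (realPhi (-exp (-π * y)) ^ 2 / realPhi (exp (-π * y)) ^ 2) ^ 2 = 1 := by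
  have hq0 := Real.exp_pos (-π * y)
  have hq1 := exp_neg_pi_mul_lt_one hy
  have h0 := realPhi_ne_zero hq0 hq1
  have h1 := realPhi_sq hq0 hq1
  have h2 := realPhi_neg_sq hq0 hq1
  have h3 := realPsi_sq hq0 hq1
  have h4 : exp (-π * y / 2) ^ 2 = exp (-π * y) := by
    rw [← Real.exp_nat_mul]; congr 1; push_cast; ring
  rw [thetaModulus, div_pow, div_pow, ← add_div, div_eq_one_iff_eq (by positivity), mul_pow, h4,
    h3, h2, h1]
  ring

lemma complementaryModulus_thetaModulus : complementaryModulus (thetaModulus y) =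
    realPhi (-exp (-π * y)) ^ 2 / realPhi (exp (-π * y)) ^ 2 :=
  complementaryModulus_eq (by positivity) (thetaModulus_sq_add hy)

lemma thetaModulus_lt_one : thetaModulus y < 1 := by
  have h1 := thetaModulus_sq_add hy
  have h2 := sq_pos_of_ne_zero (realPhi_neg_ne_zero (Real.exp_pos _) (exp_neg_pi_mul_lt_one hy))
  have h3 := sq_pos_of_ne_zero (realPhi_ne_zero (Real.exp_pos _) (exp_neg_pi_mul_lt_one hy))
  have h4 := pow_pos (div_pos h2 h3) 2
  nlinarith [thetaModulus_pos hy]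

/-- The Gauss integral is homogeneous of degree $-1$, so scaling $(1,k')$ by $\varphi(q)^2$ reduces
to the value $\pi/2$. -/
lemma ellipticK_thetaModulus :
    ellipticK (thetaModulus y) = π / 2 * realPhi (exp (-π * y)) ^ 2 := by
  have hq0 := Real.exp_pos (-π * y)
  have hq1 := exp_neg_pi_mul_lt_one hy
  have h0 := sq_pos_of_ne_zero (realPhi_ne_zero hq0 hq1)
  rw [ellipticK_eq_gaussIntegral (thetaModulus_pos hy) (thetaModulus_lt_one hy),
    complementaryModulus_thetaModulus hy, ← gaussIntegral_realPhi hq0 hq1]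
  have h := gaussIntegral_mul h0 1 (realPhi (-exp (-π * y)) ^ 2 / realPhi (exp (-π * y)) ^ 2)
  rw [mul_one, mul_div_cancel₀ _ h0.ne'] at h
  rw [h, div_mul_cancel₀ _ h0.ne']

/-- Use `gaussIntegral_realPhi` at the inverted nome $e^{-\pi/y}$: theta inversion turns its pair
into $y\varphi(e^{-\pi y})^2\cdot(1,k)$, and $K(k')$ is the Gauss integral of $(1,k)$. -/
lemma ellipticK_complementaryModulus_thetaModulus :
    ellipticK (complementaryModulus (thetaModulus y)) =
      y * (π / 2 * realPhi (exp (-π * y)) ^ 2) := by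
  have hk0 := thetaModulus_pos hy
  have hk1 := thetaModulus_lt_one hy
  have h0 := sq_pos_of_ne_zero (realPhi_ne_zero (Real.exp_pos _) (exp_neg_pi_mul_lt_one hy))
  have hcc : complementaryModulus (complementaryModulus (thetaModulus y)) = thetaModulus y :=
    complementaryModulus_eq hk0.le (by rw [complementaryModulus_sq hk0 hk1]; ring)
  rw [ellipticK_eq_gaussIntegral (complementaryModulus_pos hk0 hk1)
    (complementaryModulus_lt_one hk0), hcc]
  have e : exp (-π / y) = exp (-π * y⁻¹) := by rw [div_eq_mul_inv]
  have h1 := gaussIntegral_realPhi (Real.exp_pos (-π / y))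
    (by rw [e]; exact exp_neg_pi_mul_lt_one (inv_pos.2 hy))
  rw [realPhi_exp_div hy, realPhi_neg_exp_div hy] at h1
  have hc : 0 < y * realPhi (exp (-π * y)) ^ 2 := mul_pos hy h0
  have h2 := gaussIntegral_mul hc 1 (thetaModulus y)
  have e1 : (√y * realPhi (exp (-π * y))) ^ 2 = y * realPhi (exp (-π * y)) ^ 2 * 1 := by
    rw [mul_pow, Real.sq_sqrt hy.le, mul_one]
  have e2 : (√y * (exp (-π * y / 4) * realPsi (exp (-π * y)))) ^ 2 =
      y * realPhi (exp (-π * y)) ^ 2 * thetaModulus y := by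
    have e3 : exp (-π * y / 4) ^ 2 = exp (-π * y / 2) := by
      rw [← Real.exp_nat_mul]; congr 1; push_cast; ring
    rw [mul_pow, mul_pow, Real.sq_sqrt hy.le, e3, thetaModulus, mul_assoc,
      mul_div_cancel₀ _ h0.ne']
  rw [e1, e2, h2] at h1
  rw [div_eq_iff hc.ne'] at h1
  rw [h1]
  ring

theorem isSingularValue_thetaModulus {p : ℝ} (hp : √p = y) :
    IsSingularValue p (thetaModulus y) := by
  refine ⟨thetaModulus_pos hy, thetaModulus_lt_one hy, ?_⟩
  rw [ellipticK_complementaryModulus_thetaModulus hy, ellipticK_thetaModulus hy, hp]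
  have h0 := sq_pos_of_ne_zero (realPhi_ne_zero (Real.exp_pos _) (exp_neg_pi_mul_lt_one hy))
  exact mul_div_cancel_right₀ _ (mul_pos (half_pos Real.pi_pos) h0).ne'

lemma thetaModulus_mul_ellipticK_sq :
    thetaModulus y * complementaryModulus (thetaModulus y) * ellipticK (thetaModulus y) ^ 2 =
      π ^ 2 / 4 * (exp (-π * y / 2) * realPsi (exp (-π * y)) ^ 2 *
        realPhi (-exp (-π * y)) ^ 2) := by
  have h0 := realPhi_ne_zero (Real.exp_pos _) (exp_neg_pi_mul_lt_one hy)
  rw [complementaryModulus_thetaModulus hy, ellipticK_thetaModulus hy, thetaModulus]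
  generalize realPhi (exp (-π * y)) = P at *
  ring_nf
  field_simp

end modulus

/-! ### The signed triangular sum as a theta value at an imaginary argument -/

/-- The sum over signed triangular numbers in terms of the theta function. -/
lemma hasSum_triangular {Q : ℝ} (hQ0 : 0 < Q) (hQ1 : Q < 1) :
    HasSum (fun n : ℕ => (-1 : ℂ) ^ (n * (n + 1) / 2) * (Q : ℂ) ^ (n * (n + 1)))
      (psi (Complex.I * Q) / 2) := by
  obtain ⟨h1, h2⟩ := ofReal_ne_zero_and_norm_lt hQ0 hQ1
  -- The indices $n$ and $-n-1$ have the same exponent, hence the division by $2$; the signs are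
  -- $i^{n(n+1)}=(-1)^{n(n+1)/2}$.
  have h3 := (summable_psi (mul_ne_zero Complex.I_ne_zero h1)
    (show ‖Complex.I * (Q : ℂ)‖ < 1 by simpa using h2)).hasSum.nat_add_neg_add_one.div_const 2
  refine h3.congr_fun fun n => ?_
  have e1 : (-((n : ℤ) + 1)) * (-((n : ℤ) + 1) + 1) = ((n * (n + 1) : ℕ) : ℤ) := by
    push_cast; ring
  have e2 : (n : ℤ) * (n + 1) = ((n * (n + 1) : ℕ) : ℤ) := by push_cast; ring
  rw [e1, e2, zpow_natCast, mul_pow]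
  obtain ⟨m, hm⟩ := Nat.even_mul_succ_self n
  have e3 : n * (n + 1) = 2 * m := by rw [← two_mul] at hm; exact hm
  rw [e3, Nat.mul_div_cancel_left _ two_pos, pow_mul Complex.I, Complex.I_sq]
  ring

/-- The relation between the signed triangular sum and the theta constants. -/
lemma psi_I_mul_pow_four {Q : ℝ} (hQ0 : 0 < Q) (hQ1 : Q < 1) :
    (psi (Complex.I * Q) / 2) ^ 4 =
      ((realPsi (Q ^ 2) ^ 2 * realPhi (-Q ^ 2) ^ 2 / 4 : ℝ) : ℂ) := by
  obtain ⟨h1, h2⟩ := ofReal_ne_zero_and_norm_lt hQ0 hQ1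
  have h3 := psi_sq (mul_ne_zero Complex.I_ne_zero h1)
    (show ‖Complex.I * (Q : ℂ)‖ < 1 by simpa using h2)
  rw [mul_pow, Complex.I_sq, neg_one_mul, psi_neg] at h3
  rw [div_pow, show psi (Complex.I * Q) ^ 4 = (psi (Complex.I * Q) ^ 2) ^ 2 by ring, h3]
  push_cast
  rw [ofReal_realPhi, ofReal_realPsi]
  push_cast
  ring

end

end EtaTheta


namespace EtaTheta

open Filter Topology ModularForm
open Complex hiding eta
open UpperHalfPlane hiding I
open scoped Real

noncomputable section

/-! ### The cube of the Dedekind eta function -/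

lemma norm_cexp_pi_I_mul_lt_one {τ : ℂ} (hτ : 0 < τ.im) : ‖cexp (π * I * τ)‖ < 1 := by
  rw [Complex.norm_exp, Real.exp_lt_one_iff]
  have : (π * I * τ).re = -(π * τ.im) := by simp
  rw [this]
  exact neg_neg_of_pos (mul_pos Real.pi_pos hτ)

lemma eta_eq_eulerProd (τ : ℂ) :
    eta τ = cexp (2 * π * I * τ / 24) * eulerProd (cexp (π * I * τ) ^ 2) := by
  rw [ModularForm.eta, Function.Periodic.qParam, eulerProd]
  congr 1
  refine tprod_congr fun n => ?_
  rw [eta_q_eq_pow, ← Complex.exp_nat_mul (π * I * τ)]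
  congr 3
  push_cast
  ring

/-- Jacobi's series for the cube of the eta function. -/
theorem hasSum_eta_pow_three {τ : ℂ} (hτ : 0 < τ.im) :
    HasSum (fun n : ℕ => (-1) ^ n * (2 * n + 1) * cexp (π * I * τ * (2 * n + 1) ^ 2 / 4))
      (eta τ ^ 3) := by
  set q := cexp (π * I * τ) with hq
  have hq0 : q ≠ 0 := Complex.exp_ne_zero _
  have hq1 : ‖q‖ < 1 := norm_cexp_pi_I_mul_lt_one hτ
  -- Fold the sum over ℤ: $k=n$ contributes weight $n$ and $k=-n-1$ weight $n+1$ with the same sign,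
  -- giving $2n+1$.
  have h := ((summable_mul_zpow_mul_zpow_sq hq0 hq1
    (neg_ne_zero.2 hq0)).hasSum.nat_add_neg_add_one.mul_left (cexp (π * I * τ / 4)))
  rw [← eulerProd_pow_three hq0 hq1] at h
  have h1 : eta τ ^ 3 = cexp (π * I * τ / 4) * eulerProd (q ^ 2) ^ 3 := by
    rw [eta_eq_eulerProd, mul_pow, ← Complex.exp_nat_mul]
    congr 2
    push_cast
    ring
  rw [h1]
  refine h.congr_fun fun n => ?_
  have e1 : cexp (π * I * τ * (2 * n + 1) ^ 2 / 4) = cexp (π * I * τ / 4) * q ^ (n + n ^ 2) := by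
    rw [hq, ← Complex.exp_nat_mul, ← Complex.exp_add]
    congr 1
    push_cast
    ring
  have e2 : (-q) ^ (-((n : ℤ) + 1)) * q ^ ((-((n : ℤ) + 1)) ^ 2) = -((-1) ^ n * q ^ (n + n ^ 2)) := by
    have : ((-((n : ℤ) + 1)) ^ 2) = ((n + 1 : ℕ) : ℤ) + ((n + n ^ 2 : ℕ) : ℤ) := by
      push_cast; ring
    rw [this, zpow_add₀ hq0, zpow_neg, ← Nat.cast_add_one, zpow_natCast, zpow_natCast, zpow_natCast,
      neg_pow q, mul_inv, pow_succ (-1 : ℂ)]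
    have h2 : ((-1 : ℂ) ^ n * (-1))⁻¹ = -(-1) ^ n := by
      rcases neg_one_pow_eq_or ℂ n with h | h <;> rw [h] <;> norm_num
    rw [h2]
    have := pow_ne_zero (n + 1) hq0
    field_simp
  have e3 : (-q) ^ (n : ℤ) * q ^ ((n : ℤ) ^ 2) = (-1) ^ n * q ^ (n + n ^ 2) := by
    have : ((n : ℤ) ^ 2) = ((n ^ 2 : ℕ) : ℤ) := by push_cast; ring
    rw [this, zpow_natCast, zpow_natCast, neg_pow q, pow_add]
    ring
  rw [e1, e2, e3]
  push_cast
  ring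

lemma eta_I_div {y : ℝ} (hy : 0 < y) : eta (I / y) = √y * eta (I * y) := by
  have h := eta_comp_eq_csqrt_I_inv (show (I * y : ℂ) ∈ upperHalfPlaneSet by simpa using hy)
  have e : -1 / (I * (y : ℂ)) = I / y := by
    rw [div_eq_div_iff (by simp [hy.ne']) (by simp [hy.ne'])]
    linear_combination (-(y : ℂ)) * I_mul_I
  simp only [Function.comp_apply, e, Pi.smul_apply, Pi.mul_apply, smul_eq_mul] at h
  have h2 : Complex.sqrt (I * y) = Complex.sqrt I * √y := by
    have hI := I_ne_zero
    have hy' : (y : ℂ) ≠ 0 := ofReal_ne_zero.2 hy.ne'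
    rw [Real.sqrt_eq_rpow, ofReal_cpow hy.le, Complex.sqrt, Complex.sqrt, cpow_def_of_ne_zero hI,
      cpow_def_of_ne_zero hy', cpow_def_of_ne_zero (mul_ne_zero hI hy'), mul_comm I,
      log_ofReal_mul hy hI, ← Complex.exp_add, ← ofReal_log hy.le]
    congr 1
    push_cast
    ring
  have h3 : Complex.sqrt I ≠ 0 := by
    rw [Complex.sqrt, Ne, cpow_eq_zero_iff]
    exact fun h => I_ne_zero h.1
  rw [h, h2]
  field_simp

/-- The cube of the eta function on the imaginary axis. -/
def etaCube (y : ℝ) : ℂ := eta (I * y) ^ 3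

lemma hasSum_etaCube {y : ℝ} (hy : 0 < y) :
    HasSum (fun n : ℕ => (((-1) ^ n * (2 * n + 1) * Real.exp (-(π * y * (2 * n + 1) ^ 2 / 4)) : ℝ) : ℂ))
      (etaCube y) := by
  refine (hasSum_eta_pow_three (τ := I * y) (by simpa using hy)).congr_fun fun n => ?_
  push_cast
  congr 2
  linear_combination (-(π * y * (2 * n + 1) ^ 2 / 4 : ℂ)) * I_mul_I

lemma etaCube_one_div {y : ℝ} (hy : 0 < y) : etaCube (1 / y) = ((y ^ (3 / 2 : ℝ) : ℝ) : ℂ) * etaCube y := by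
  rw [etaCube, etaCube]
  have : I * ((1 / y : ℝ) : ℂ) = I / y := by push_cast; ring
  rw [this, eta_I_div hy, mul_pow]
  congr 1
  norm_cast
  rw [Real.sqrt_eq_rpow, ← Real.rpow_natCast, ← Real.rpow_mul hy.le]
  norm_num

lemma continuousOn_etaCube : ContinuousOn etaCube (Set.Ioi 0) := by
  intro y (hy : 0 < y)
  have h1 : ContinuousAt eta (I * y) :=
    (differentiableAt_eta_of_mem_upperHalfPlaneSet
      (show (I * y : ℂ) ∈ upperHalfPlaneSet by simpa using hy)).continuousAt
  have h2 : ContinuousAt (fun y : ℝ => I * (y : ℂ)) y := by fun_prop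
  exact ((ContinuousAt.comp (f := fun y : ℝ => I * (y : ℂ)) h1 h2).pow 3).continuousWithinAt

lemma isBigO_etaCube (a : ℝ) : etaCube =O[atTop] fun y => y ^ a := by
  -- Compare termwise with the series at $1/2$: for $x=(2n+1)^2\ge1$ and $y\ge1$ one has $xy/4\ge
  -- x/8+y/8$.
  have h1 : etaCube =O[atTop] fun y => Real.exp (-(π / 8) * y) := by
    have hs := (hasSum_etaCube (show (0 : ℝ) < 1 / 2 by norm_num)).summable.norm
    refine Asymptotics.IsBigO.of_bound (∑' n : ℕ, ‖(((-1) ^ n * (2 * n + 1) *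
      Real.exp (-(π * (1 / 2) * (2 * n + 1) ^ 2 / 4)) : ℝ) : ℂ)‖) ?_
    filter_upwards [eventually_ge_atTop 1] with y hy
    have hs' := (hasSum_etaCube (show 0 < y by linarith)).summable.norm
    rw [← (hasSum_etaCube (show 0 < y by linarith)).tsum_eq]
    refine (norm_tsum_le_tsum_norm hs').trans ?_
    rw [← tsum_mul_right]
    refine hs'.tsum_le_tsum (fun n => ?_) (hs.mul_right _)
    rw [Complex.norm_real, Complex.norm_real, norm_mul, norm_mul _ (Real.exp _), Real.norm_eq_abs (Real.exp _),
      Real.norm_eq_abs (Real.exp _), Real.norm_eq_abs (Real.exp _), Real.abs_exp, Real.abs_exp,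
      Real.abs_exp, mul_assoc ‖_‖, ← Real.exp_add]
    refine mul_le_mul_of_nonneg_left (Real.exp_le_exp.2 ?_) (norm_nonneg _)
    have h3 : (1 : ℝ) ≤ (2 * n + 1) ^ 2 := one_le_pow₀ (by linarith [n.cast_nonneg (α := ℝ)])
    nlinarith [Real.pi_pos, mul_nonneg (sub_nonneg.2 hy) (sub_nonneg.2 h3),
      mul_nonneg Real.pi_pos.le (mul_nonneg (sub_nonneg.2 hy) (sub_nonneg.2 h3)),
      mul_nonneg Real.pi_pos.le (sub_nonneg.2 h3)]
  exact h1.trans (isLittleO_exp_neg_mul_rpow_atTop (by positivity) a).isBigO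

end

end EtaTheta


namespace EtaTheta

open Filter Topology ModularForm
open Complex hiding eta
open UpperHalfPlane hiding I
open scoped Real Manifold

noncomputable section

/-! ### The Fourier expansion -/

/-- The coefficients in the double series of the eta product. -/
def thetaCoeff (p : ℕ × ℕ) : ℂ := (-1) ^ (p.1 + p.2) * ((2 * p.1 + 1) * (2 * p.2 + 1))

/-- The exponents in the double series of the eta product. -/
def thetaExponent (r s : ℕ) (p : ℕ × ℕ) : ℕ := (r * (2 * p.1 + 1) ^ 2 + s * (2 * p.2 + 1) ^ 2) / 8

/-- The coefficients of the Fourier expansion of the eta product, as sums over representations by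
the quadratic form. -/
def etaProductCoeff (r s N : ℕ) : ℂ :=
  ∑' p : {p : ℕ × ℕ // thetaExponent r s p = N}, thetaCoeff p

section

variable {r s : ℕ}

/-- Odd squares are $1$ modulo $8$, so the form is congruent to $r+s$. This is where the congruence
enters: it makes the exponents integral. -/
lemma eight_mul_thetaExponent (hrs : r + s ≡ 0 [MOD 8]) (p : ℕ × ℕ) :
    8 * thetaExponent r s p = r * (2 * p.1 + 1) ^ 2 + s * (2 * p.2 + 1) ^ 2 := by
  refine Nat.mul_div_cancel' ?_
  obtain ⟨a, ha⟩ := Nat.even_mul_succ_self p.1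
  obtain ⟨b, hb⟩ := Nat.even_mul_succ_self p.2
  obtain ⟨c, hc⟩ := (Nat.modEq_zero_iff_dvd).1 hrs
  refine ⟨r * a + s * b + c, ?_⟩
  zify at ha hb hc ⊢
  linear_combination (4 * (r : ℤ)) * ha + (4 * (s : ℤ)) * hb + hc

/-- From $rx^2+sy^2\ge x^2+y^2\ge 2xy$. It gives positivity of the exponents and convergence of the
Dirichlet series. -/
lemma mul_le_thetaExponent (hr : 0 < r) (hs : 0 < s) (hrs : r + s ≡ 0 [MOD 8]) (p : ℕ × ℕ) :
    ((2 * p.1 + 1) * (2 * p.2 + 1) : ℝ) / 4 ≤ thetaExponent r s p := by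
  have h : (8 * thetaExponent r s p : ℝ) = r * (2 * p.1 + 1) ^ 2 + s * (2 * p.2 + 1) ^ 2 := by
    exact_mod_cast eight_mul_thetaExponent hrs p
  have h1 : (1 : ℝ) ≤ r := by exact_mod_cast hr
  have h2 : (1 : ℝ) ≤ s := by exact_mod_cast hs
  nlinarith [sq_nonneg ((2 * p.1 + 1 : ℝ) - (2 * p.2 + 1)),
    mul_nonneg (sub_nonneg.2 h1) (sq_nonneg (2 * p.1 + 1 : ℝ)),
    mul_nonneg (sub_nonneg.2 h2) (sq_nonneg (2 * p.2 + 1 : ℝ))]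

lemma thetaExponent_pos (hr : 0 < r) (hs : 0 < s) (hrs : r + s ≡ 0 [MOD 8]) (p : ℕ × ℕ) :
    0 < thetaExponent r s p := by
  have h := mul_le_thetaExponent hr hs hrs p
  have : (0 : ℝ) < thetaExponent r s p := lt_of_lt_of_le (by positivity) h
  exact_mod_cast this

lemma etaProductCoeff_zero (hr : 0 < r) (hs : 0 < s) (hrs : r + s ≡ 0 [MOD 8]) :
    etaProductCoeff r s 0 = 0 := by
  have : IsEmpty {p : ℕ × ℕ // thetaExponent r s p = 0} :=
    ⟨fun p => (thetaExponent_pos hr hs hrs p).ne' p.2⟩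
  exact tsum_empty

lemma hasSum_etaProduct_prod (hr : 0 < r) (hs : 0 < s) (hrs : r + s ≡ 0 [MOD 8]) (τ : ℍ) :
    HasSum (fun p => thetaCoeff p * cexp (2 * π * I * τ) ^ thetaExponent r s p)
      (etaProduct r s τ) := by
  have him : ∀ {n : ℕ}, 0 < n → 0 < ((n : ℂ) * (τ : ℂ)).im := fun {n} hn => by
    have : ((n : ℂ) * (τ : ℂ)).im = n * τ.im := by simp
    rw [this]
    exact mul_pos (by exact_mod_cast hn) τ.im_pos
  have h1 := hasSum_eta_pow_three (him hr)
  have h2 := hasSum_eta_pow_three (him hs)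
  have h0 := (summable_mul_of_summable_norm h1.summable.norm h2.summable.norm).hasSum
  rw [← tsum_mul_tsum_of_summable_norm h1.summable.norm h2.summable.norm, h1.tsum_eq,
    h2.tsum_eq] at h0
  refine h0.congr_fun fun p => ?_
  have h3 : (8 * thetaExponent r s p : ℂ) = r * (2 * p.1 + 1) ^ 2 + s * (2 * p.2 + 1) ^ 2 := by
    exact_mod_cast eight_mul_thetaExponent hrs p
  rw [thetaCoeff, mul_mul_mul_comm, ← Complex.exp_nat_mul, ← Complex.exp_add]
  congr 1
  · rw [pow_add]; ring
  · congr 1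
    linear_combination (π * I * τ / 4) * h3

/-- Regrouping by the value of `E`. Finiteness of the fibres is not needed, since subfamilies of a
summable family are summable in a complete space. -/
lemma hasSum_tsum_fiber {ι α : Type*} [NormedAddCommGroup α] [CompleteSpace α] {f : ι → α} {a : α}
    (h : HasSum f a) (E : ι → ℕ) : HasSum (fun N => ∑' p : {p // E p = N}, f p) a :=
  ((Equiv.sigmaFiberEquiv E).hasSum_iff.2 h).sigma fun _ =>
    (h.summable.comp_injective Subtype.val_injective).hasSum

/-- The Fourier expansion of the eta product. -/
theorem hasSum_etaProduct (hr : 0 < r) (hs : 0 < s) (hrs : r + s ≡ 0 [MOD 8]) (τ : ℍ) :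
    HasSum (fun N : ℕ => etaProductCoeff r s N • Function.Periodic.qParam 1 (τ : ℂ) ^ N)
      (etaProduct r s τ) := by
  have e : Function.Periodic.qParam 1 (τ : ℂ) = cexp (2 * π * I * τ) := by
    simp [Function.Periodic.qParam]
  refine (hasSum_tsum_fiber (hasSum_etaProduct_prod hr hs hrs τ) (thetaExponent r s)).congr_fun
    fun N => ?_
  rw [e, etaProductCoeff, smul_eq_mul, ← tsum_mul_right]
  exact tsum_congr fun p => by rw [p.2]

lemma periodic_etaProduct (hr : 0 < r) (hs : 0 < s) (hrs : r + s ≡ 0 [MOD 8]) :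
    Function.Periodic (etaProduct r s ∘ ofComplex) ((1 : ℝ) : ℂ) := by
  intro w
  by_cases! hw : 0 < w.im
  · have h1 : 0 < (w + (1 : ℝ)).im := by simp [hw]
    simp only [Function.comp_apply, ofComplex_apply_of_im_pos h1, ofComplex_apply_of_im_pos hw]
    refine (hasSum_etaProduct hr hs hrs ⟨_, h1⟩).unique
      ((hasSum_etaProduct hr hs hrs ⟨w, hw⟩).congr_fun fun N => ?_)
    exact congr_arg (fun x => etaProductCoeff r s N • x ^ N) (show Function.Periodic.qParam 1 w =
        Function.Periodic.qParam 1 (w + (1 : ℝ)) by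
        rw [Function.Periodic.qParam, Function.Periodic.qParam, Complex.exp_eq_exp_iff_exists_int]
        exact ⟨-1, by push_cast; ring⟩).symm
  -- Off the upper half-plane `ofComplex` takes one fixed default value, so periodicity is trivial
  -- there.
  · have h1 : (w + (1 : ℝ)).im ≤ 0 := by simpa using hw
    rw [Function.comp_apply, Function.comp_apply, ofComplex_apply_of_im_nonpos h1,
      ofComplex_apply_of_im_nonpos hw]

lemma mdifferentiable_etaProduct (hr : 0 < r) (hs : 0 < s) : MDiff (etaProduct r s) := by
  rw [UpperHalfPlane.mdifferentiable_iff]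
  have key : ∀ {n : ℕ}, 0 < n → DifferentiableOn ℂ (fun z => eta ((n : ℂ) * z) ^ 3)
      {z | 0 < z.im} := fun {n} hn z (hz : 0 < z.im) => by
    have h1 : ((n : ℂ) * z) ∈ upperHalfPlaneSet := by
      have : ((n : ℂ) * z).im = n * z.im := by simp
      simp only [upperHalfPlaneSet, Set.mem_ofPred_eq, this]
      exact mul_pos (by exact_mod_cast hn) hz
    have h2 := (differentiableAt_eta_of_mem_upperHalfPlaneSet h1).comp z
      ((differentiableAt_id (𝕜 := ℂ)).const_mul (n : ℂ))
    exact (h2.pow 3).differentiableWithinAt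
  refine ((key hr).mul (key hs)).congr fun z hz => ?_
  simp [etaProduct, ofComplex_apply_of_im_pos hz]

lemma fourierCoefficient_etaProduct (hr : 0 < r) (hs : 0 < s) (hrs : r + s ≡ 0 [MOD 8]) :
    fourierCoefficient (etaProduct r s) = etaProductCoeff r s := by
  let _ : FunLike (ℍ → ℂ) ℍ ℂ := ⟨fun f => f, fun _ _ h => h⟩
  funext N
  have h := hasSum_etaProduct hr hs hrs
  exact (qExpansion_coeff_unique (etaProduct r s) one_pos
    (analyticAt_cuspFunction_zero one_pos (periodic_etaProduct hr hs hrs)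
      (mdifferentiable_etaProduct hr hs) (isBoundedAtImInfty_of_hasSum_qExpansion one_pos h))
    h N).symm

/-! ### The Dirichlet series -/

/-- By `mul_le_thetaExponent`, a term $xy/N^3$ is at most $64/(xy)^2$ in absolute value, which is
summable over pairs of odd $x,y$. -/
lemma lSeriesSummable_etaProductCoeff (hr : 0 < r) (hs : 0 < s) (hrs : r + s ≡ 0 [MOD 8]) :
    LSeriesSummable (etaProductCoeff r s) 3 := by
  have h1 : Summable fun m : ℕ => 1 / (2 * m + 1 : ℝ) ^ 2 := by
    have := (Real.summable_one_div_nat_pow.2 one_lt_two).comp_injective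
      (i := fun m : ℕ => 2 * m + 1) (fun a b h => by simpa using h)
    refine this.congr fun m => ?_
    simp
  have h2 : Summable fun p : ℕ × ℕ => thetaCoeff p / (thetaExponent r s p : ℂ) ^ 3 := by
    refine Summable.of_norm_bounded ((h1.mul_of_nonneg h1 (fun _ => by positivity)
      (fun _ => by positivity)).mul_left 64) fun p => ?_
    have h3 := mul_le_thetaExponent hr hs hrs p
    have h4 : ‖thetaCoeff p‖ = (2 * p.1 + 1) * (2 * p.2 + 1) := by
      rw [thetaCoeff, norm_mul, norm_pow, norm_neg, norm_one, one_pow, one_mul]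
      have : ((2 * p.1 + 1) * (2 * p.2 + 1) : ℂ) = (((2 * p.1 + 1) * (2 * p.2 + 1) : ℝ) : ℂ) := by
        push_cast; rfl
      rw [this, norm_real, Real.norm_of_nonneg (by positivity)]
    rw [norm_div, norm_pow, norm_natCast, h4]
    set x : ℝ := 2 * p.1 + 1
    set y : ℝ := 2 * p.2 + 1
    have hx : 0 < x := by positivity
    have hy : 0 < y := by positivity
    calc x * y / (thetaExponent r s p : ℝ) ^ 3 ≤ x * y / (x * y / 4) ^ 3 := by gcongr
      _ = 64 * (1 / x ^ 2 * (1 / y ^ 2)) := by field_simp; norm_num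
  refine (hasSum_tsum_fiber h2.hasSum (thetaExponent r s)).summable.congr fun N => ?_
  rcases eq_or_ne N 0 with rfl | hN
  · rw [LSeries.term_zero]
    have : IsEmpty {p : ℕ × ℕ // thetaExponent r s p = 0} :=
      ⟨fun p => (thetaExponent_pos hr hs hrs p).ne' p.2⟩
    exact tsum_empty
  · rw [LSeries.term_of_ne_zero hN, cpow_ofNat, etaProductCoeff, ← tsum_div_const]
    exact tsum_congr fun p => by rw [p.2]

lemma abscissaOfAbsConv_etaProductCoeff_le (hr : 0 < r) (hs : 0 < s) (hrs : r + s ≡ 0 [MOD 8]) :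
    LSeries.abscissaOfAbsConv (etaProductCoeff r s) ≤ (3 : ℝ) := by
  simpa using (lSeriesSummable_etaProductCoeff hr hs hrs).abscissaOfAbsConv_le

/-! ### The continuation of the Dirichlet series -/

lemma isBigO_etaCube_const_mul {c : ℝ} (hc : 0 < c) (a : ℝ) :
    (fun t => etaCube (c * t)) =O[atTop] fun t => t ^ a := by
  refine ((isBigO_etaCube a).comp_tendsto (tendsto_id.const_mul_atTop hc)).trans ?_
  refine Asymptotics.IsBigO.of_bound (c ^ a) ?_
  filter_upwards [eventually_ge_atTop 0] with t ht
  rw [Function.comp_apply, id, Real.mul_rpow hc.le ht, norm_mul,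
    Real.norm_of_nonneg (Real.rpow_nonneg hc.le a)]

/-- The functional equation pair of the eta product on the imaginary axis. -/
def etaFEPair (hr : 0 < r) (hs : 0 < s) : WeakFEPair ℂ where
  f t := etaCube (r * t) * etaCube (s * t)
  g t := etaCube (t / r) * etaCube (t / s)
  -- Two factors of weight $3/2$ each; their scalings produce the constant $(rs)^{-3/2}$.
  k := 3
  ε := (((r * s : ℝ) ^ (-(3 / 2) : ℝ) : ℝ) : ℂ)
  f₀ := 0
  g₀ := 0
  hf_int := by
    have hr' : (0 : ℝ) < r := by exact_mod_cast hr
    have hs' : (0 : ℝ) < s := by exact_mod_cast hs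
    refine ContinuousOn.locallyIntegrableOn ?_ measurableSet_Ioi
    refine (continuousOn_etaCube.comp (by fun_prop) ?_).mul
      (continuousOn_etaCube.comp (by fun_prop) ?_)
    · exact fun t (ht : 0 < t) => mul_pos hr' ht
    · exact fun t (ht : 0 < t) => mul_pos hs' ht
  hg_int := by
    have hr' : (0 : ℝ) < r := by exact_mod_cast hr
    have hs' : (0 : ℝ) < s := by exact_mod_cast hs
    refine ContinuousOn.locallyIntegrableOn ?_ measurableSet_Ioi
    refine (continuousOn_etaCube.comp (by fun_prop) ?_).mul
      (continuousOn_etaCube.comp (by fun_prop) ?_)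
    · exact fun t (ht : 0 < t) => div_pos ht hr'
    · exact fun t (ht : 0 < t) => div_pos ht hs'
  hk := by norm_num
  hε := by
    have hr' : (0 : ℝ) < r := by exact_mod_cast hr
    have hs' : (0 : ℝ) < s := by exact_mod_cast hs
    exact ofReal_ne_zero.2 (Real.rpow_pos_of_pos (mul_pos hr' hs') _).ne'
  h_feq := by
    intro x (hx : 0 < x)
    have hr' : (0 : ℝ) < r := by exact_mod_cast hr
    have hs' : (0 : ℝ) < s := by exact_mod_cast hs
    have e1 : (r : ℝ) * (1 / x) = 1 / (x / r) := by field_simp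
    have e2 : (s : ℝ) * (1 / x) = 1 / (x / s) := by field_simp
    rw [e1, e2, etaCube_one_div (div_pos hx hr'), etaCube_one_div (div_pos hx hs'), smul_eq_mul,
      mul_mul_mul_comm]
    congr 1
    norm_cast
    rw [← Real.mul_rpow (by positivity) (by positivity), Real.rpow_neg (by positivity),
      show x / r * (x / s) = x ^ 2 / (r * s) by field_simp, Real.div_rpow (by positivity)
      (by positivity), ← Real.rpow_natCast, ← Real.rpow_mul hx.le]
    norm_num
    rw [div_eq_inv_mul]
  hf_top a := by
    have hr' : (0 : ℝ) < r := by exact_mod_cast hr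
    have hs' : (0 : ℝ) < s := by exact_mod_cast hs
    simpa using (isBigO_etaCube_const_mul hr' a).mul (isBigO_etaCube_const_mul hs' 0)
  hg_top a := by
    have hr' : (0 : ℝ) < (r : ℝ)⁻¹ := by positivity
    have hs' : (0 : ℝ) < (s : ℝ)⁻¹ := by positivity
    simpa [div_eq_inv_mul] using
      (isBigO_etaCube_const_mul hr' a).mul (isBigO_etaCube_const_mul hs' 0)

lemma isStrongFEPair_etaFEPair (hr : 0 < r) (hs : 0 < s) : IsStrongFEPair (etaFEPair hr hs) :=
  ⟨rfl, rfl⟩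

/-- The `L`-function of the eta product. -/
def etaL (hr : 0 < r) (hs : 0 < s) (z : ℂ) : ℂ :=
  (etaFEPair hr hs).Λ z * ((2 * π : ℝ) : ℂ) ^ z * (Complex.Gamma z)⁻¹

lemma differentiable_etaL (hr : 0 < r) (hs : 0 < s) : Differentiable ℂ (etaL hr hs) := by
  refine ((isStrongFEPair_etaFEPair hr hs).differentiable_Λ.mul ?_).mul differentiable_one_div_Gamma
  have : ((2 * π : ℝ) : ℂ) ≠ 0 := ofReal_ne_zero.2 Real.two_pi_pos.ne'
  exact fun z => (differentiableAt_id.const_cpow (Or.inl this))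

lemma etaL_eq_LSeries (hr : 0 < r) (hs : 0 < s) (hrs : r + s ≡ 0 [MOD 8]) {z : ℂ}
    (hz : 3 < z.re) : etaL hr hs z = LSeries (etaProductCoeff r s) z := by
  have habs : LSeries.abscissaOfAbsConv (etaProductCoeff r s) < (z.re : EReal) :=
    (abscissaOfAbsConv_etaProductCoeff_le hr hs hrs).trans_lt (by exact_mod_cast hz)
  have hsum := LSeriesSummable_of_abscissaOfAbsConv_lt_re habs
  have h2pi := Real.two_pi_pos
  have hm := hasSum_mellin (a := etaProductCoeff r s) (p := fun N => 2 * π * N)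
    (F := (etaFEPair hr hs).f) (s := z) (fun N => ?_) (by linarith) (fun t ht => ?_) ?_
  · rw [← (isStrongFEPair_etaFEPair hr hs).Λ_eq] at hm
    have hG : Complex.Gamma z ≠ 0 := Complex.Gamma_ne_zero_of_re_pos (by linarith)
    have hc : ((2 * π : ℝ) : ℂ) ^ z ≠ 0 := by
      rw [Ne, cpow_eq_zero_iff]
      exact fun h => ofReal_ne_zero.2 h2pi.ne' h.1
    rw [etaL, LSeries]
    refine (((hm.mul_right (((2 * π : ℝ) : ℂ) ^ z)).mul_right (Complex.Gamma z)⁻¹).congr_fun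
      fun N => ?_).tsum_eq.symm
    rcases eq_or_ne N 0 with rfl | hN
    · rw [LSeries.term_zero, etaProductCoeff_zero hr hs hrs]
      simp
    · rw [LSeries.term_of_ne_zero hN, ofReal_mul, mul_cpow_ofReal_nonneg h2pi.le N.cast_nonneg,
        ofReal_natCast]
      have : (N : ℂ) ^ z ≠ 0 := by
        rw [Ne, cpow_eq_zero_iff]
        exact fun h => Nat.cast_ne_zero.2 hN h.1
      field_simp
  · rcases eq_or_ne N 0 with rfl | hN
    · exact Or.inl (etaProductCoeff_zero hr hs hrs)
    · exact Or.inr (mul_pos h2pi (by exact_mod_cast Nat.pos_of_ne_zero hN))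
  · have h := hasSum_etaProduct hr hs hrs ⟨I * t, by simpa using ht⟩
    have e : etaProduct r s ⟨I * t, by simpa using ht⟩ = (etaFEPair hr hs).f t := by
      simp only [etaProduct, etaFEPair, etaCube]
      congr 3 <;> push_cast <;> ring_nf
    rw [e] at h
    refine h.congr_fun fun N => ?_
    rw [smul_eq_mul, Function.Periodic.qParam, ← Complex.exp_nat_mul]
    push_cast
    congr 2
    linear_combination (-(2 * π * N * t) : ℂ) * I_mul_I
  · refine ((hsum.norm.div_const ((2 * π) ^ z.re))).congr fun N => ?_
    rcases eq_or_ne N 0 with rfl | hN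
    · rw [LSeries.term_zero, etaProductCoeff_zero hr hs hrs]
      simp
    · rw [LSeries.term_of_ne_zero hN, Real.mul_rpow h2pi.le N.cast_nonneg, norm_div,
        norm_natCast_cpow_of_pos (Nat.pos_of_ne_zero hN), div_div, mul_comm (_ ^ _)]

/-- The abscissa is only bounded by $3$, so agreement on $\operatorname{Re} z>3$ is carried to the
whole half-plane of absolute convergence by the identity theorem, which needs connectedness. -/
lemma isPreconnected_lt_re (x : EReal) : IsPreconnected {z : ℂ | x < (z.re : EReal)} := by
  refine (Convex.isPreconnected ?_)
  intro z hz w hw a b ha hb hab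
  simp only [Set.mem_ofPred_eq] at *
  have h : min z.re w.re ≤ (a • z + b • w).re := by
    simp only [add_re, real_smul, mul_re, ofReal_re, ofReal_im, zero_mul, sub_zero]
    calc min z.re w.re = a * min z.re w.re + b * min z.re w.re := by rw [← add_mul, hab, one_mul]
      _ ≤ _ := by gcongr; exacts [min_le_left _ _, min_le_right _ _]
  refine lt_of_lt_of_le ?_ (EReal.coe_le_coe_iff.2 h)
  rcases min_choice z.re w.re with h | h <;> rw [h] <;> assumption

theorem isLFunction_etaL (hr : 0 < r) (hs : 0 < s) (hrs : r + s ≡ 0 [MOD 8]) :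
    IsLFunction (etaProductCoeff r s) (etaL hr hs) where
  abscissa_lt_top := (abscissaOfAbsConv_etaProductCoeff_le hr hs hrs).trans_lt (EReal.coe_lt_top _)
  entire := differentiable_etaL hr hs
  eq_LSeries := by
    intro z hz
    have h4 : LSeries.abscissaOfAbsConv (etaProductCoeff r s) < (((4 : ℂ)).re : EReal) :=
      (abscissaOfAbsConv_etaProductCoeff_le hr hs hrs).trans_lt (by norm_num)
    refine AnalyticOnNhd.eqOn_of_preconnected_of_eventuallyEq (𝕜 := ℂ)
      (fun w _ => (differentiable_etaL hr hs).analyticAt w)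
      (LSeries_analyticOnNhd (etaProductCoeff r s)) (isPreconnected_lt_re _) h4 ?_ hz
    have ho : IsOpen {w : ℂ | 3 < w.re} := isOpen_lt continuous_const continuous_re
    filter_upwards [ho.mem_nhds (show (4 : ℂ) ∈ _ by simp; norm_num)] with w hw
    exact etaL_eq_LSeries hr hs hrs hw

/-- An entire continuation of a Dirichlet series is unique. -/
theorem isLFunction_unique {a : ℕ → ℂ} {L M : ℂ → ℂ} (hL : IsLFunction a L)
    (hM : IsLFunction a M) : L = M := by
  obtain ⟨x, hx⟩ := EReal.lt_iff_exists_real_btwn.1 hL.abscissa_lt_top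
  refine AnalyticOnNhd.eq_of_eventuallyEq (𝕜 := ℂ) (z₀ := ((x + 1 : ℝ) : ℂ))
    (fun w _ => hL.entire.analyticAt w) (fun w _ => hM.entire.analyticAt w) ?_
  have ho : IsOpen {w : ℂ | x < w.re} := isOpen_lt continuous_const continuous_re
  filter_upwards [ho.mem_nhds (show ((x + 1 : ℝ) : ℂ) ∈ _ by simp)] with w hw
  have : LSeries.abscissaOfAbsConv a < (w.re : EReal) := hx.1.trans (by exact_mod_cast hw)
  rw [hL.eq_LSeries w this, hM.eq_LSeries w this]

end

end

end EtaTheta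


namespace EtaTheta

open Filter Topology MeasureTheory
open Complex hiding eta
open scoped Real

noncomputable section

/-! ### The value at two -/

section

variable {r s : ℕ}

/-- The terms of the double series for `y * f (i y)`, after inversion in the second factor. -/
lemma hasSum_mul_etaFEPair (hr : 0 < r) (hs : 0 < s) {y : ℝ} (hy : 0 < y) :
    HasSum (fun p : ℕ × ℕ => (((s : ℝ) ^ (-(3 / 2) : ℝ) * ((-1) ^ (p.1 + p.2) * ((2 * p.1 + 1) *
      (2 * p.2 + 1))) * ((√y)⁻¹ * Real.exp (-((2 * p.1 + 1) * √(π * r) / 2) ^ 2 * y -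
        ((2 * p.2 + 1) * √(π / s) / 2) ^ 2 / y)) : ℝ) : ℂ))
      ((y : ℂ) * (etaFEPair hr hs).f y) := by
  have hr' : (0 : ℝ) < r := by exact_mod_cast hr
  have hs' : (0 : ℝ) < s := by exact_mod_cast hs
  have h1 := hasSum_etaCube (mul_pos hr' hy)
  have h2 := hasSum_etaCube (y := 1 / (s * y)) (by positivity)
  have h0 := (summable_mul_of_summable_norm h1.summable.norm h2.summable.norm).hasSum
  rw [← tsum_mul_tsum_of_summable_norm h1.summable.norm h2.summable.norm, h1.tsum_eq,
    h2.tsum_eq, etaCube_one_div (mul_pos hs' hy)] at h0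
  -- Undoing the inversion costs $(sy)^{-3/2}$; with the Mellin weight $y$ this leaves
  -- $s^{-3/2}y^{-1/2}$, the weight of the elementary Bessel integral.
  have h3 := h0.mul_left (((y * (s * y) ^ (-(3 / 2) : ℝ) : ℝ)) : ℂ)
  have e1 : ((y * (s * y) ^ (-(3 / 2) : ℝ) : ℝ) : ℂ) *
      (etaCube (r * y) * ((((s * y : ℝ) ^ (3 / 2 : ℝ) : ℝ) : ℂ) * etaCube (s * y))) =
      (y : ℂ) * (etaFEPair hr hs).f y := by
    have : ((s * y : ℝ) ^ (-(3 / 2) : ℝ)) * ((s * y : ℝ) ^ (3 / 2 : ℝ)) = 1 := by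
      rw [← Real.rpow_add (by positivity)]; norm_num
    have h4 : (((s * y : ℝ) ^ (-(3 / 2) : ℝ) : ℝ) : ℂ) * (((s * y : ℝ) ^ (3 / 2 : ℝ) : ℝ) : ℂ) = 1 := by
      exact_mod_cast this
    simp only [etaFEPair]
    rw [ofReal_mul]
    linear_combination (y * etaCube (r * y) * etaCube (s * y)) * h4
  rw [e1] at h3
  refine h3.congr_fun fun p => ?_
  rw [← ofReal_mul, ← ofReal_mul]
  congr 1
  have e2 : y * (s * y) ^ (-(3 / 2) : ℝ) = (s : ℝ) ^ (-(3 / 2) : ℝ) * (√y)⁻¹ := by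
    rw [Real.mul_rpow hs'.le hy.le, Real.sqrt_eq_rpow, ← Real.rpow_neg hy.le]
    have : y * y ^ (-(3 / 2) : ℝ) = y ^ (-(1 / 2) : ℝ) := by
      nth_rewrite 1 [← Real.rpow_one y]
      rw [← Real.rpow_add hy]
      norm_num
    rw [← this]
    ring
  have e3 : Real.exp (-((2 * p.1 + 1) * √(π * r) / 2) ^ 2 * y -
        ((2 * p.2 + 1) * √(π / s) / 2) ^ 2 / y) =
      Real.exp (-(π * (r * y) * (2 * p.1 + 1) ^ 2 / 4)) *
        Real.exp (-(π * (1 / (s * y)) * (2 * p.2 + 1) ^ 2 / 4)) := by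
    rw [← Real.exp_add]
    congr 1
    have h5 := Real.sq_sqrt (show 0 ≤ π * r by positivity)
    have h6 := Real.sq_sqrt (show 0 ≤ π / s by positivity)
    rw [div_pow, mul_pow, h5, div_pow, mul_pow, h6]
    field_simp
    ring
  rw [e2, e3, pow_add]
  ring

/-- The denominator $2m+1$ will cancel one coefficient of the eta series, and
$2\alpha\beta=\frac{\pi}{2}\sqrt{r/s}\,(2m+1)(2n+1)$ gives the Lambert exponent. -/
lemma integral_theta_term (hr : 0 < r) (hs : 0 < s) (p : ℕ × ℕ) (c : ℝ) :
    ∫ y in Set.Ioi 0, c * ((√y)⁻¹ * Real.exp (-((2 * p.1 + 1) * √(π * r) / 2) ^ 2 * y -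
        ((2 * p.2 + 1) * √(π / s) / 2) ^ 2 / y)) =
      c * (2 / ((2 * p.1 + 1) * √r) * Real.exp (-π * √(r / s) / 2) ^
        ((2 * p.1 + 1) * (2 * p.2 + 1))) := by
  have hr' : (0 : ℝ) < r := by exact_mod_cast hr
  have hs' : (0 : ℝ) < s := by exact_mod_cast hs
  have hπ := Real.pi_pos
  rw [integral_const_mul, integral_inv_sqrt_mul_exp (by positivity) (by positivity),
    ← Real.exp_nat_mul, Real.sqrt_mul hπ.le, Real.sqrt_div hπ.le, Real.sqrt_div hr'.le]
  congr 2
  · have := Real.sqrt_pos.2 hπ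
    field_simp
  · congr 1
    push_cast
    field_simp
    have := Real.sq_sqrt hπ.le
    linear_combination -this

/-- Each term has constant sign, so its $L^1$ norm is the absolute value of its integral. Absolute
convergence of the twisted Lambert series then permits exchanging sum and integral. -/
lemma mellin_etaFEPair_two (hr : 0 < r) (hs : 0 < s) :
    mellin (etaFEPair hr hs).f 2 = ((2 / √(r * s ^ 3) : ℝ) : ℂ) *
      (Real.exp (-π * √(r / s) / 2) * (psi (I * Real.exp (-π * √(r / s) / 2)) / 2) ^ 4) := by
  have hr' : (0 : ℝ) < r := by exact_mod_cast hr
  have hs' : (0 : ℝ) < s := by exact_mod_cast hs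
  have hy : 0 < √((r : ℝ) / s) := Real.sqrt_pos.2 (div_pos hr' hs')
  set Q := Real.exp (-π * √(r / s) / 2) with hQ
  have hQ0 : 0 < Q := Real.exp_pos _
  have hQ1 : Q < 1 := by
    rw [hQ, Real.exp_lt_one_iff]
    nlinarith [mul_pos Real.pi_pos hy]
  obtain ⟨hq0, hq1⟩ := ofReal_ne_zero_and_norm_lt hQ0 hQ1
  have hL := (hasSum_twisted_lambert hq0 hq1).mul_left ((2 / √(r * s ^ 3) : ℝ) : ℂ)
  set F : ℕ × ℕ → ℝ → ℝ := fun p y => ((s : ℝ) ^ (-(3 / 2) : ℝ) * ((-1) ^ (p.1 + p.2) *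
    ((2 * p.1 + 1) * (2 * p.2 + 1))) * ((√y)⁻¹ * Real.exp (-((2 * p.1 + 1) * √(π * r) / 2) ^ 2 * y -
        ((2 * p.2 + 1) * √(π / s) / 2) ^ 2 / y))) with hF
  set V : ℕ × ℕ → ℝ := fun p => 2 / √(r * s ^ 3) * ((-1) ^ (p.1 + p.2) * (2 * p.2 + 1) *
    Q ^ ((2 * p.1 + 1) * (2 * p.2 + 1))) with hV
  have hc : (s : ℝ) ^ (-(3 / 2) : ℝ) = (√((s : ℝ) ^ 3))⁻¹ := by
    rw [Real.rpow_neg hs'.le, Real.sqrt_eq_rpow, ← Real.rpow_natCast, ← Real.rpow_mul hs'.le]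
    norm_num
  have hval : ∀ p, ∫ y in Set.Ioi 0, F p y = V p := fun p => by
    rw [hF, hV]
    simp only
    rw [integral_theta_term hr hs, hc, Real.sqrt_mul hr'.le, ← hQ]
    have := Real.sqrt_pos.2 hr'
    have := Real.sqrt_pos.2 (pow_pos hs' 3)
    field_simp
  have hV0 : ∀ p, V p ≠ 0 := fun p => by
    have h1 := pow_ne_zero (p.1 + p.2) (show (-1 : ℝ) ≠ 0 by norm_num)
    have h2 : 0 < √((r : ℝ) * s ^ 3) := Real.sqrt_pos.2 (by positivity)
    have h3 : (0 : ℝ) < 2 * p.2 + 1 := by positivity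
    exact mul_ne_zero (div_ne_zero two_ne_zero h2.ne') (mul_ne_zero (mul_ne_zero h1 h3.ne')
      (pow_ne_zero _ hQ0.ne'))
  -- A non-integrable function has integral $0$ by convention, so the nonzero value `V p` forces
  -- integrability.
  have hint : ∀ p, IntegrableOn (F p) (Set.Ioi 0) := fun p => by
    by_contra h
    exact hV0 p ((hval p).symm.trans (integral_undef h))
  have hVc : HasSum (fun p => (V p : ℂ)) (((2 / √(r * s ^ 3) : ℝ) : ℂ) *
      (Q * (psi (I * Q) / 2) ^ 4)) := by
    refine hL.congr_fun fun p => ?_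
    rw [hV]
    push_cast
    ring
  have habs : ∀ p, ∫ y in Set.Ioi 0, ‖(F p y : ℂ)‖ = ‖(V p : ℂ)‖ := fun p => by
    rw [← hval p, norm_real, Real.norm_eq_abs]
    rcases neg_one_pow_eq_or ℝ (p.1 + p.2) with h | h
    · have h1 : ∀ y, 0 ≤ F p y := fun y => by rw [hF]; simp only; rw [h]; positivity
      rw [abs_of_nonneg (integral_nonneg h1)]
      exact integral_congr_ae (Eventually.of_forall fun y => by
        simp only [norm_real, Real.norm_of_nonneg (h1 y)])
    · have h1 : ∀ y, 0 ≤ -F p y := fun y => by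
        rw [hF]; simp only; rw [h, neg_one_mul, mul_neg, neg_mul, neg_neg]; positivity
      have h2 : ∫ y in Set.Ioi 0, F p y = -∫ y in Set.Ioi 0, -F p y := by
        rw [integral_neg, neg_neg]
      rw [h2, abs_neg, abs_of_nonneg (integral_nonneg h1)]
      exact integral_congr_ae (Eventually.of_forall fun y => by
        simp only [norm_real]
        rw [← norm_neg, Real.norm_of_nonneg (h1 y)])
  have hsum := hasSum_integral_of_summable_integral_norm (μ := volume.restrict (Set.Ioi (0 : ℝ)))
    (F := fun p y => (F p y : ℂ)) (fun p => (hint p).ofReal)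
    (hVc.summable.norm.congr fun p => (habs p).symm)
  have h1 : ∀ p, ∫ y in Set.Ioi 0, (F p y : ℂ) = V p := fun p => by
    rw [← hval p]; exact integral_ofReal
  rw [mellin, ← (hsum.congr_fun fun p => (h1 p).symm).unique hVc]
  refine setIntegral_congr_fun measurableSet_Ioi fun y (hy : 0 < y) => ?_
  rw [(hasSum_mul_etaFEPair hr hs hy).tsum_eq, smul_eq_mul]
  congr 1
  norm_num

/-- The value of the `L`-function at two in terms of a theta function. -/
theorem etaL_two (hr : 0 < r) (hs : 0 < s) :
    etaL hr hs 2 = ((8 * π ^ 2 / √(r * s ^ 3) : ℝ) : ℂ) *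
      (Real.exp (-π * √(r / s) / 2) * (psi (I * Real.exp (-π * √(r / s) / 2)) / 2) ^ 4) := by
  have h : Complex.Gamma 2 = 1 := by
    rw [show (2 : ℂ) = ((1 : ℕ) : ℂ) + 1 by norm_num, Complex.Gamma_nat_eq_factorial]
    simp
  rw [etaL, (isStrongFEPair_etaFEPair hr hs).Λ_eq, mellin_etaFEPair_two hr hs, h, cpow_ofNat]
  push_cast
  ring

end

end

end EtaTheta


/-! ### The triangular series with fractional exponents -/

namespace EtaTheta

open Real

noncomputable section

/-- The sum over signed triangular numbers with fractional exponents in terms of `psi`. -/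
lemma hasSum_triangular_rpow {Q : ℝ} (hQ0 : 0 < Q) (hQ1 : Q < 1) :
    HasSum (fun n : ℕ => (-1 : ℝ) ^ (n * (n + 1) / 2) * (Q ^ 2) ^ ((2 * (n : ℝ) + 1) ^ 2 / 8))
      (Q ^ (1 / 4 : ℝ) * (psi (Complex.I * Q) / 2).re) := by
  refine ((Complex.hasSum_re (hasSum_triangular hQ0 hQ1)).mul_left _).congr_fun fun n => ?_
  have h1 : (-1 : ℂ) ^ (n * (n + 1) / 2) * (Q : ℂ) ^ (n * (n + 1)) =
      (((-1 : ℝ) ^ (n * (n + 1) / 2) * Q ^ (n * (n + 1)) : ℝ) : ℂ) := by push_cast; rfl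
  -- The factor $Q^{1/4}$ splits off because $(2n+1)^2/4=n(n+1)+1/4$.
  rw [h1, Complex.ofReal_re, ← Real.rpow_natCast Q 2, ← Real.rpow_mul hQ0.le, ← Real.rpow_natCast,
    ← Real.rpow_natCast Q, mul_left_comm, ← Real.rpow_add hQ0]
  congr 2
  push_cast
  ring

/-- The theta value $\psi(iQ)/2$ is real because its folded series has real terms, and the fourth
power turns $Q^{1/4}$ into $Q$. -/
lemma ofReal_tsum_triangular_pow_four {Q : ℝ} (hQ0 : 0 < Q) (hQ1 : Q < 1) :
    (((∑' n : ℕ, (-1 : ℝ) ^ (n * (n + 1) / 2) * (Q ^ 2) ^ ((2 * (n : ℝ) + 1) ^ 2 / 8)) ^ 4 : ℝ) : ℂ) =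
      Q * (psi (Complex.I * Q) / 2) ^ 4 := by
  have h1 : (((psi (Complex.I * Q) / 2).re : ℝ) : ℂ) = psi (Complex.I * Q) / 2 := by
    have h2 : HasSum (fun n : ℕ => ((((-1 : ℂ) ^ (n * (n + 1) / 2) * (Q : ℂ) ^ (n * (n + 1))).re : ℝ) : ℂ))
        (((psi (Complex.I * Q) / 2).re : ℝ) : ℂ) :=
      Complex.hasSum_ofReal.2 (Complex.hasSum_re (hasSum_triangular hQ0 hQ1))
    refine h2.unique ((hasSum_triangular hQ0 hQ1).congr_fun fun n => ?_)
    have h3 : (-1 : ℂ) ^ (n * (n + 1) / 2) * (Q : ℂ) ^ (n * (n + 1)) =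
      (((-1 : ℝ) ^ (n * (n + 1) / 2) * Q ^ (n * (n + 1)) : ℝ) : ℂ) := by push_cast; rfl
    rw [h3, Complex.ofReal_re]
  rw [(hasSum_triangular_rpow hQ0 hQ1).tsum_eq, mul_pow, ← Real.rpow_mul_natCast hQ0.le,
    show (1 / 4 : ℝ) * (4 : ℕ) = 1 by norm_num, Real.rpow_one, Complex.ofReal_mul,
    Complex.ofReal_pow, h1]

end

end EtaTheta

/-! ### The main theorem -/

open EtaTheta in
theorem theorem4p1 (r s : ℕ) (hr : 0 < r) (hs : 0 < s) (hrs : r + s ≡ 0 [MOD 8]) :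
    -- `f` has a Fourier expansion without constant term, an `L`-function, and the singular
    -- value `k_{r/s}` exists and is unique
    (fourierCoefficient (etaProduct r s) 0 = 0 ∧
      ∀ τ : UpperHalfPlane,
        HasSum (fun n : ℕ => fourierCoefficient (etaProduct r s) n *
          Complex.exp (2 * Real.pi * Complex.I * n * (τ : ℂ))) (etaProduct r s τ)) ∧
    (∃! L : ℂ → ℂ, IsLFunction (fourierCoefficient (etaProduct r s)) L) ∧
    (∃! k : ℝ, IsSingularValue ((r : ℝ) / s) k) ∧
    -- the evaluation of `L(f, 2)`
    ∀ (L : ℂ → ℂ) (k q : ℝ),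
      IsLFunction (fourierCoefficient (etaProduct r s)) L →
      IsSingularValue ((r : ℝ) / s) k →
      q = Real.exp (-Real.pi * Real.sqrt ((r : ℝ) / s)) →
      Summable (fun n : ℕ =>
        (-1 : ℝ) ^ (n * (n + 1) / 2) * q ^ ((2 * (n : ℝ) + 1) ^ 2 / 8)) ∧
      L 2 = ((8 * Real.pi ^ 2 / Real.sqrt ((r : ℝ) * (s : ℝ) ^ 3) *
        (∑' n : ℕ, (-1 : ℝ) ^ (n * (n + 1) / 2) * q ^ ((2 * (n : ℝ) + 1) ^ 2 / 8)) ^ 4 : ℝ) : ℂ) ∧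
      L 2 = ((8 / Real.sqrt ((r : ℝ) * (s : ℝ) ^ 3) *
        k * complementaryModulus k * ellipticK k ^ 2 : ℝ) : ℂ) := by
  rw [fourierCoefficient_etaProduct hr hs hrs]
  have hy : 0 < √((r : ℝ) / s) :=
    Real.sqrt_pos.2 (div_pos (by exact_mod_cast hr) (by exact_mod_cast hs))
  have hk := isSingularValue_thetaModulus hy (p := (r : ℝ) / s) rfl
  have hL := isLFunction_etaL hr hs hrs
  refine ⟨⟨etaProductCoeff_zero hr hs hrs, fun τ => ?_⟩,
    ⟨_, hL, fun M hM => isLFunction_unique hM hL⟩,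
    ⟨_, hk, fun l hl => isSingularValue_unique hl hk⟩, ?_⟩
  · refine (hasSum_etaProduct hr hs hrs τ).congr_fun fun n => ?_
    rw [smul_eq_mul, Function.Periodic.qParam, ← Complex.exp_nat_mul]
    congr 2
    push_cast
    ring
  · intro M k q hM hk' hq
    obtain rfl := isLFunction_unique hM hL
    obtain rfl := isSingularValue_unique hk' hk
    -- The Bessel integrals produce the nome $Q=\sqrt q$, whereas the singular modulus belongs to
    -- $q=Q^2$.
    set Q := Real.exp (-Real.pi * √((r : ℝ) / s) / 2) with hQ
    have hQ0 : 0 < Q := Real.exp_pos _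
    have hQ1 : Q < 1 := by
      rw [hQ, Real.exp_lt_one_iff]
      nlinarith [mul_pos Real.pi_pos hy]
    have hqQ : q = Q ^ 2 := by
      rw [hq, hQ, ← Real.exp_nat_mul]
      congr 1
      push_cast
      ring
    rw [hqQ]
    refine ⟨(hasSum_triangular_rpow hQ0 hQ1).summable, ?_, ?_⟩
    · rw [etaL_two hr hs, Complex.ofReal_mul, ofReal_tsum_triangular_pow_four hQ0 hQ1]
    · have h1 := thetaModulus_mul_ellipticK_sq hy
      rw [etaL_two hr hs, psi_I_mul_pow_four hQ0 hQ1, ← hqQ, hq, ← Complex.ofReal_mul,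
        ← Complex.ofReal_mul]
      congr 1
      rw [mul_assoc, mul_assoc, ← mul_assoc (thetaModulus _), h1]
      ring
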